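/- Let $A_1$ be the complex Weyl algebra generated by $a,a^\dagger$ with $[a,a^\dagger]=1$, let $\dagger$ be the conjugate-linear anti-automorphism exchanging $a$ and $a^\dagger$, and let $\hat A_1=\{p\in A_1 : p^\dagger=-p\}$, a real Lie algebra under the commutator. For $\alpha\ge\beta\ge 0$ put $g_+^{(\alpha,\beta)}=i\big((a^\dagger)^\beta a^\alpha+(a^\dagger)^\alpha a^\beta\big)$, and for $\alpha>\beta\ge 0$ put $g_-^{(\alpha,\beta)}=(a^\dagger)^\beta a^\alpha-(a^\dagger)^\alpha a^\beta$; a *single monomial* is a nonzero real multiple of one of these elements. Write $P=g_+^{(1,0)}$, $Q=g_-^{(1,0)}$, $A=g_+^{(2,0)}$, $B=g_-^{(2,0)}$, $N=ia^\dagger a$, and let $\langle\cdot\rangle_{\mathrm{Lie}}$ be the generated real Lie subalgebra of $\hat A_1$. Let $\mathfrak{aff}(1)$ have basis $e_1,e_2$ with $[e_1,e_2]=e_2$; $\mathfrak h_1$ basis $q,p,z$ with $[q,p]=z$; $\mathfrak{wh}_1$ basis $e_1,\dots,e_4$ with $[e_2,e_3]=e_1$, $[e_2,e_4]=e_2$,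 $[e_3,e_4]=-e_3$; $\mathfrak{wh}_2$ basis $h,q,p,z$ with $[h,q]=-p$, $[h,p]=q$, $[q,p]=z$; and let the Schrödinger algebra $\mathcal S=\mathfrak{sl}(2,\mathbb R)\ltimes\mathfrak h_1$ have basis $h,x,y,q,p,z$ with $[h,x]=2x$, $[h,y]=-2y$, $[x,y]=h$, $[h,q]=q$, $[h,p]=-p$, $[x,p]=q$, $[y,q]=p$, $[q,p]=z$ (brackets of basis elements not determined by these and antisymmetry are zero). **Theorem.** (1) Let $\mathcal G\subset\hat A_1$ be a finite set of single monomials such that $\mathfrak g=\langle\mathcal G\rangle_{\mathrm{Lie}}$ is finite-dimensional and non-abelian. Then every element of $\mathcal G$ is a nonzero real multiple of one of $i,\,N,\,P,\,Q,\,A,\,B$, and $\mathfrak g$ is one of the following subalgebras and is isomorphic to the algebra named there: - $\mathfrak{aff}(1)$: $\operatorname{span}\{P,B\}$, $\operatorname{span}\{Q,B\}$; - $\mathbb R\oplus\mathfrak{aff}(1)$: $\operatorname{span}\{i,P,B\}$, $\operatorname{span}\{i,Q,B\}$; - $\mathfrak h_1$: $\operatorname{span}\{i,P,Q\}$; - $\mathfrak{sl}(2,\mathbb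 R)$: $\operatorname{span}\{A,B,N+\tfrac12 i\}$; - $\mathfrak{wh}_1$: $\operatorname{span}\{i,P,Q,A\}$, $\operatorname{span}\{i,P,Q,B\}$; - $\mathfrak{wh}_2$: $\operatorname{span}\{i,N,P,Q\}$; - $\mathfrak{sl}(2,\mathbb R)\oplus\mathbb R$: $\operatorname{span}\{i,N,A,B\}$; - $\mathcal S$: $\operatorname{span}\{i,N,P,Q,A,B\}$. (2) Conversely, in each item the displayed set is linearly independent and its real span is equal to its Lie closure; this Lie subalgebra is finite-dimensional, non-abelian, generated by a finite set of single monomials, and isomorphic to the named algebra. (3) The eight named algebras are pairwise non-isomorphic, and the eleven listed subalgebras of $\hat A_1$ are pairwise distinct. -/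

import Mathlib

noncomputable section

namespace SkewWeyl

/-! ### The complex single-mode Weyl algebra and its dagger -/

/-- The two generators: annihilation and creation. -/
inductive Gen
  | lower
  | raise

/-- The canonical commutation relation `a a† = a† a + 1`. -/
inductive CCR : FreeAlgebra ℂ Gen → FreeAlgebra ℂ Gen → Prop
  | comm : CCR (FreeAlgebra.ι ℂ Gen.lower * FreeAlgebra.ι ℂ Gen.raise)
      (FreeAlgebra.ι ℂ Gen.raise * FreeAlgebra.ι ℂ Gen.lower + 1)

/-- The complex Weyl algebra `A₁`: the unital associative complex algebra on `a, a†` with the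
single relation `a a† - a† a = 1`. -/
def Weyl : Type := RingQuot CCR

instance : Ring Weyl := inferInstanceAs (Ring (RingQuot CCR))

instance : Algebra ℂ Weyl := inferInstanceAs (Algebra ℂ (RingQuot CCR))

/-- The annihilation operator `a`. -/
def ann : Weyl := RingQuot.mkAlgHom ℂ CCR (FreeAlgebra.ι ℂ Gen.lower)

/-- The creation operator `a†`. -/
def cre : Weyl := RingQuot.mkAlgHom ℂ CCR (FreeAlgebra.ι ℂ Gen.raise)

/-- The Lie bracket of `A₁` is the commutator. -/
instance : LieRing Weyl := LieRing.ofAssociativeRing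

instance : LieAlgebra ℝ Weyl := LieAlgebra.ofAssociativeAlgebra

theorem ann_mul_cre : ann * cre = cre * ann + 1 := by
  have h := RingQuot.mkAlgHom_rel ℂ CCR.comm
  rw [map_mul, map_add, map_mul, map_one] at h
  exact h

/-- The opposite algebra of `A₁`, with scalars acting through complex conjugation. Complex algebra
homomorphisms `A₁ → ConjOp` are the same as conjugate-linear anti-endomorphisms of `A₁`. -/
def ConjOp : Type := Weylᵐᵒᵖ

instance : Ring ConjOp := inferInstanceAs (Ring Weylᵐᵒᵖ)

instance : Algebra ℂ ConjOp :=
  RingHom.toAlgebra' ((algebraMap ℂ Weylᵐᵒᵖ).comp (starRingEnd ℂ))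
    fun c x => Algebra.commutes (A := Weylᵐᵒᵖ) (starRingEnd ℂ c) x

/-- The underlying element of `A₁`. -/
def ConjOp.toWeyl (x : ConjOp) : Weyl := MulOpposite.unop (α := Weyl) x

/-- An element of `A₁`, seen in the opposite algebra. -/
def ConjOp.ofWeyl (x : Weyl) : ConjOp := MulOpposite.op (α := Weyl) x

/-- The adjoint of a generator: `a ↦ a†`, `a† ↦ a`. -/
def Gen.dagger : Gen → Weyl
  | .lower => cre
  | .raise => ann

/-- The dagger, as a homomorphism to the conjugate opposite algebra. -/
def daggerHom : Weyl →ₐ[ℂ] ConjOp :=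
  RingQuot.liftAlgHom ℂ (s := CCR)
    ⟨FreeAlgebra.lift ℂ fun g => ConjOp.ofWeyl g.dagger, by
      rintro _ _ ⟨⟩
      simp only [map_mul, map_add, map_one, FreeAlgebra.lift_ι_apply]
      exact congrArg ConjOp.ofWeyl ann_mul_cre⟩

/-- The dagger: the conjugate-linear anti-automorphism of `A₁` that exchanges `a` and `a†`. -/
def dagger (x : Weyl) : Weyl := (daggerHom x).toWeyl

theorem dagger_ann : dagger ann = cre := by
  have h : daggerHom ann = ConjOp.ofWeyl cre := by
    unfold daggerHom ann
    erw [RingQuot.liftAlgHom_mkAlgHom_apply]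
    rw [FreeAlgebra.lift_ι_apply]; rfl
  unfold dagger; rw [h]; rfl

theorem dagger_cre : dagger cre = ann := by
  have h : daggerHom cre = ConjOp.ofWeyl ann := by
    unfold daggerHom cre
    erw [RingQuot.liftAlgHom_mkAlgHom_apply]
    rw [FreeAlgebra.lift_ι_apply]; rfl
  unfold dagger; rw [h]; rfl

theorem dagger_add (x y : Weyl) : dagger (x + y) = dagger x + dagger y := by
  unfold dagger; rw [map_add]; rfl

theorem dagger_zero : dagger 0 = 0 := by
  unfold dagger; rw [map_zero]; rfl

theorem dagger_one : dagger 1 = 1 := by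
  unfold dagger; rw [map_one]; rfl

theorem dagger_neg (x : Weyl) : dagger (-x) = -dagger x := by
  unfold dagger; rw [map_neg]; rfl

theorem dagger_sub (x y : Weyl) : dagger (x - y) = dagger x - dagger y := by
  rw [sub_eq_add_neg, dagger_add, dagger_neg, ← sub_eq_add_neg]

theorem dagger_mul (x y : Weyl) : dagger (x * y) = dagger y * dagger x := by
  unfold dagger; rw [map_mul]; rfl

theorem dagger_pow (x : Weyl) (n : ℕ) : dagger (x ^ n) = dagger x ^ n := by
  induction n with
  | zero => rw [pow_zero, pow_zero, dagger_one]
  | succ n ih => rw [pow_succ, dagger_mul, ih, ← pow_succ']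

theorem dagger_algebraMap (c : ℂ) :
    dagger (algebraMap ℂ Weyl c) = algebraMap ℂ Weyl (starRingEnd ℂ c) := by
  unfold dagger; rw [AlgHom.commutes]; rfl

theorem dagger_smul (c : ℂ) (x : Weyl) : dagger (c • x) = starRingEnd ℂ c • dagger x := by
  rw [Algebra.smul_def, dagger_mul, dagger_algebraMap, Algebra.smul_def, Algebra.commutes]

theorem dagger_real_smul (c : ℝ) (x : Weyl) : dagger (c • x) = c • dagger x := by
  rw [← Complex.coe_smul, dagger_smul, Complex.conj_ofReal, Complex.coe_smul]

/-! ### The real skew-hermitian Weyl algebra and its monomials -/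

/-- The skew-hermitian Weyl algebra `Â₁ = {p ∈ A₁ | p† = -p}`, a real Lie algebra under the
commutator. -/
def skewWeyl : LieSubalgebra ℝ Weyl where
  carrier := {p | dagger p = -p}
  add_mem' {x y} hx hy := by
    change dagger (x + y) = -(x + y)
    rw [dagger_add, hx, hy, neg_add]
  zero_mem' := by
    change dagger 0 = -0
    rw [dagger_zero, neg_zero]
  smul_mem' c x hx := by
    change dagger (c • x) = -(c • x)
    rw [dagger_real_smul, hx, smul_neg]
  lie_mem' {x y} hx hy := by
    change dagger ⁅x, y⁆ = -⁅x, y⁆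
    rw [Ring.lie_def, dagger_sub, dagger_mul, dagger_mul, hx, hy]
    noncomm_ring

/-- The normal-ordered monomial `a^(α,β) = (a†)^α a^β`. -/
def normal (α β : ℕ) : Weyl := cre ^ α * ann ^ β

theorem dagger_normal (α β : ℕ) : dagger (normal α β) = normal β α := by
  unfold normal
  rw [dagger_mul, dagger_pow, dagger_pow, dagger_ann, dagger_cre]

/-- `g₊^(α,β) = i ((a†)^β a^α + (a†)^α a^β)`. -/
def gPlus (α β : ℕ) : skewWeyl :=
  ⟨Complex.I • (normal β α + normal α β), by
    change dagger _ = - _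
    rw [dagger_smul, dagger_add, dagger_normal, dagger_normal, Complex.conj_I, neg_smul,
      add_comm]⟩

/-- `g₋^(α,β) = (a†)^β a^α - (a†)^α a^β`. -/
def gMinus (α β : ℕ) : skewWeyl :=
  ⟨normal β α - normal α β, by
    change dagger _ = - _
    rw [dagger_sub, dagger_normal, dagger_normal, neg_sub]⟩

/-- The element `i = g₊^(0,0) / 2`. -/
def imag : skewWeyl :=
  ⟨Complex.I • (1 : Weyl), by
    change dagger _ = - _
    rw [dagger_smul, dagger_one, Complex.conj_I, neg_smul]⟩

/-- The element `i a† a = g₊^(1,1) / 2`. -/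
def number : skewWeyl :=
  ⟨Complex.I • (cre * ann), by
    change dagger _ = - _
    rw [dagger_smul, dagger_mul, dagger_ann, dagger_cre, Complex.conj_I, neg_smul]⟩

/-- A single monomial of `Â₁`: a nonzero real multiple of some `g₊^(α,β)` with `α ≥ β` or of some
`g₋^(α,β)` with `α > β`. -/
def IsMonomial (x : skewWeyl) : Prop :=
  ∃ c : ℝ, c ≠ 0 ∧ ∃ α β : ℕ,
    (β ≤ α ∧ x = c • gPlus α β) ∨ (β < α ∧ x = c • gMinus α β)

/-- The Lie closure `⟨G⟩_Lie` in `Â₁`. -/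
abbrev lieClosure (G : Set skewWeyl) : LieSubalgebra ℝ skewWeyl :=
  LieSubalgebra.lieSpan ℝ skewWeyl G

/-- The Lie subalgebra is generated by a finite set of single monomials. -/
def IsMonomialGenerated (g : LieSubalgebra ℝ skewWeyl) : Prop :=
  ∃ G : Set skewWeyl, G.Finite ∧ (∀ x ∈ G, IsMonomial x) ∧ lieClosure G = g

/-! ### The abstract Lie algebras

Vectors are written in coordinates with respect to the stated basis. -/

/-- The one-dimensional (abelian) Lie algebra `ℝ`. -/
def Line : Type := ℝ

instance : AddCommGroup Line := inferInstanceAs (AddCommGroup ℝ)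

instance : Module ℝ Line := inferInstanceAs (Module ℝ ℝ)

instance : LieRing Line where
  bracket _ _ := 0
  add_lie _ _ _ := (add_zero 0).symm
  lie_add _ _ _ := (add_zero 0).symm
  lie_self _ := rfl
  leibniz_lie _ _ _ := (add_zero 0).symm

instance : LieAlgebra ℝ Line where
  lie_smul c _ _ := (smul_zero c).symm

/-- The affine algebra `aff(1)`: basis `e₁, e₂` with `[e₁, e₂] = e₂`. -/
def Aff : Type := Fin 2 → ℝ

instance : AddCommGroup Aff := inferInstanceAs (AddCommGroup (Fin 2 → ℝ))

instance : Module ℝ Aff := inferInstanceAs (Module ℝ (Fin 2 → ℝ))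

/-- The bracket of `Aff` in coordinates. -/
def affBr (u v : Fin 2 → ℝ) : Fin 2 → ℝ :=
  ![0, u 0 * v 1 - u 1 * v 0]

instance : LieRing Aff where
  bracket := affBr
  add_lie (u v w : Fin 2 → ℝ) := by
    change affBr (u + v) w = affBr u w + affBr v w
    ext i; fin_cases i <;> simp [affBr] <;> ring
  lie_add (u v w : Fin 2 → ℝ) := by
    change affBr u (v + w) = affBr u v + affBr u w
    ext i; fin_cases i <;> simp [affBr] <;> ring
  lie_self (u : Fin 2 → ℝ) := by
    change affBr u u = 0
    ext i; fin_cases i <;> simp [affBr] <;> ring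
  leibniz_lie (u v w : Fin 2 → ℝ) := by
    change affBr u (affBr v w) = affBr (affBr u v) w + affBr v (affBr u w)
    ext i; fin_cases i <;> simp [affBr] <;> ring

instance : LieAlgebra ℝ Aff where
  lie_smul (c : ℝ) (u v : Fin 2 → ℝ) := by
    change affBr u (c • v) = c • affBr u v
    ext i; fin_cases i <;> simp [affBr] <;> ring

/-- The Heisenberg algebra `h₁`: basis `q, p, z` with `[q, p] = z` and `z` central. -/
def Heis : Type := Fin 3 → ℝ

instance : AddCommGroup Heis := inferInstanceAs (AddCommGroup (Fin 3 → ℝ))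

instance : Module ℝ Heis := inferInstanceAs (Module ℝ (Fin 3 → ℝ))

/-- The bracket of `Heis` in coordinates. -/
def heisBr (u v : Fin 3 → ℝ) : Fin 3 → ℝ :=
  ![0, 0, u 0 * v 1 - u 1 * v 0]

instance : LieRing Heis where
  bracket := heisBr
  add_lie (u v w : Fin 3 → ℝ) := by
    change heisBr (u + v) w = heisBr u w + heisBr v w
    ext i; fin_cases i <;> simp [heisBr] <;> ring
  lie_add (u v w : Fin 3 → ℝ) := by
    change heisBr u (v + w) = heisBr u v + heisBr u w
    ext i; fin_cases i <;> simp [heisBr] <;> ring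
  lie_self (u : Fin 3 → ℝ) := by
    change heisBr u u = 0
    ext i; fin_cases i <;> simp [heisBr] <;> ring
  leibniz_lie (u v w : Fin 3 → ℝ) := by
    change heisBr u (heisBr v w) = heisBr (heisBr u v) w + heisBr v (heisBr u w)
    ext i; fin_cases i <;> simp [heisBr] <;> ring

instance : LieAlgebra ℝ Heis where
  lie_smul (c : ℝ) (u v : Fin 3 → ℝ) := by
    change heisBr u (c • v) = c • heisBr u v
    ext i; fin_cases i <;> simp [heisBr] <;> ring

/-- The Wigner-Heisenberg algebra `wh₁`: basis `e₁, e₂, e₃, e₄` with `[e₂, e₃] = e₁`,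
`[e₂, e₄] = e₂`, `[e₃, e₄] = -e₃` and `e₁` central. -/
def WH1 : Type := Fin 4 → ℝ

instance : AddCommGroup WH1 := inferInstanceAs (AddCommGroup (Fin 4 → ℝ))

instance : Module ℝ WH1 := inferInstanceAs (Module ℝ (Fin 4 → ℝ))

/-- The bracket of `WH1` in coordinates. -/
def wh1Br (u v : Fin 4 → ℝ) : Fin 4 → ℝ :=
  ![u 1 * v 2 - u 2 * v 1, u 1 * v 3 - u 3 * v 1, -(u 2 * v 3 - u 3 * v 2), 0]

instance : LieRing WH1 where
  bracket := wh1Br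
  add_lie (u v w : Fin 4 → ℝ) := by
    change wh1Br (u + v) w = wh1Br u w + wh1Br v w
    ext i; fin_cases i <;> simp [wh1Br] <;> ring
  lie_add (u v w : Fin 4 → ℝ) := by
    change wh1Br u (v + w) = wh1Br u v + wh1Br u w
    ext i; fin_cases i <;> simp [wh1Br] <;> ring
  lie_self (u : Fin 4 → ℝ) := by
    change wh1Br u u = 0
    ext i; fin_cases i <;> simp [wh1Br] <;> ring
  leibniz_lie (u v w : Fin 4 → ℝ) := by
    change wh1Br u (wh1Br v w) = wh1Br (wh1Br u v) w + wh1Br v (wh1Br u w)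
    ext i; fin_cases i <;> simp [wh1Br] <;> ring

instance : LieAlgebra ℝ WH1 where
  lie_smul (c : ℝ) (u v : Fin 4 → ℝ) := by
    change wh1Br u (c • v) = c • wh1Br u v
    ext i; fin_cases i <;> simp [wh1Br] <;> ring

/-- The Wigner-Heisenberg algebra `wh₂`: basis `h, q, p, z` with `[h, q] = -p`, `[h, p] = q`,
`[q, p] = z` and `z` central. -/
def WH2 : Type := Fin 4 → ℝ

instance : AddCommGroup WH2 := inferInstanceAs (AddCommGroup (Fin 4 → ℝ))

instance : Module ℝ WH2 := inferInstanceAs (Module ℝ (Fin 4 → ℝ))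

/-- The bracket of `WH2` in coordinates. -/
def wh2Br (u v : Fin 4 → ℝ) : Fin 4 → ℝ :=
  ![0, u 0 * v 2 - u 2 * v 0, -(u 0 * v 1 - u 1 * v 0), u 1 * v 2 - u 2 * v 1]

instance : LieRing WH2 where
  bracket := wh2Br
  add_lie (u v w : Fin 4 → ℝ) := by
    change wh2Br (u + v) w = wh2Br u w + wh2Br v w
    ext i; fin_cases i <;> simp [wh2Br] <;> ring
  lie_add (u v w : Fin 4 → ℝ) := by
    change wh2Br u (v + w) = wh2Br u v + wh2Br u w
    ext i; fin_cases i <;> simp [wh2Br] <;> ring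
  lie_self (u : Fin 4 → ℝ) := by
    change wh2Br u u = 0
    ext i; fin_cases i <;> simp [wh2Br] <;> ring
  leibniz_lie (u v w : Fin 4 → ℝ) := by
    change wh2Br u (wh2Br v w) = wh2Br (wh2Br u v) w + wh2Br v (wh2Br u w)
    ext i; fin_cases i <;> simp [wh2Br] <;> ring

instance : LieAlgebra ℝ WH2 where
  lie_smul (c : ℝ) (u v : Fin 4 → ℝ) := by
    change wh2Br u (c • v) = c • wh2Br u v
    ext i; fin_cases i <;> simp [wh2Br] <;> ring

/-- The Schrödinger algebra `sl(2,ℝ) ⋉ h₁`: basis `h, x, y, q, p, z` with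
`[h, x] = 2x`, `[h, y] = -2y`, `[x, y] = h`, `[h, q] = q`, `[h, p] = -p`, `[x, q] = 0`,
`[x, p] = q`, `[y, q] = p`, `[y, p] = 0`, `[q, p] = z` and `z` central. -/
def Schr : Type := Fin 6 → ℝ

instance : AddCommGroup Schr := inferInstanceAs (AddCommGroup (Fin 6 → ℝ))

instance : Module ℝ Schr := inferInstanceAs (Module ℝ (Fin 6 → ℝ))

/-- The bracket of `Schr` in coordinates. -/
def schrBr (u v : Fin 6 → ℝ) : Fin 6 → ℝ :=
  ![u 1 * v 2 - u 2 * v 1,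
    2 * (u 0 * v 1 - u 1 * v 0),
    -(2 * (u 0 * v 2 - u 2 * v 0)),
    (u 0 * v 3 - u 3 * v 0) + (u 1 * v 4 - u 4 * v 1),
    -(u 0 * v 4 - u 4 * v 0) + (u 2 * v 3 - u 3 * v 2),
    u 3 * v 4 - u 4 * v 3]

instance : LieRing Schr where
  bracket := schrBr
  add_lie (u v w : Fin 6 → ℝ) := by
    change schrBr (u + v) w = schrBr u w + schrBr v w
    ext i; fin_cases i <;> simp [schrBr] <;> ring
  lie_add (u v w : Fin 6 → ℝ) := by
    change schrBr u (v + w) = schrBr u v + schrBr u w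
    ext i; fin_cases i <;> simp [schrBr] <;> ring
  lie_self (u : Fin 6 → ℝ) := by
    change schrBr u u = 0
    ext i; fin_cases i <;> simp [schrBr] <;> ring
  leibniz_lie (u v w : Fin 6 → ℝ) := by
    change schrBr u (schrBr v w) = schrBr (schrBr u v) w + schrBr v (schrBr u w)
    ext i; fin_cases i <;> simp [schrBr] <;> ring

instance : LieAlgebra ℝ Schr where
  lie_smul (c : ℝ) (u v : Fin 6 → ℝ) := by
    change schrBr u (c • v) = c • schrBr u v
    ext i; fin_cases i <;> simp [schrBr] <;> ring

/-! ### The glossary -/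

/-- Names for the eight algebras of the glossary. -/
inductive Kind
  | aff
  | lineAff
  | heis
  | sl2
  | wh1
  | wh2
  | sl2Line
  | schr

/-- The real Lie algebra `L` is isomorphic to the algebra of the given name. -/
def Kind.Iso (k : Kind) (L : Type) [LieRing L] [LieAlgebra ℝ L] : Prop :=
  match k with
  | .aff => Nonempty (L ≃ₗ⁅ℝ⁆ Aff)
  | .lineAff => Nonempty (L ≃ₗ⁅ℝ⁆ Line × Aff)
  | .heis => Nonempty (L ≃ₗ⁅ℝ⁆ Heis)
  | .sl2 => Nonempty (L ≃ₗ⁅ℝ⁆ LieAlgebra.SpecialLinear.sl (Fin 2) ℝ)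
  | .wh1 => Nonempty (L ≃ₗ⁅ℝ⁆ WH1)
  | .wh2 => Nonempty (L ≃ₗ⁅ℝ⁆ WH2)
  | .sl2Line => Nonempty (L ≃ₗ⁅ℝ⁆ LieAlgebra.SpecialLinear.sl (Fin 2) ℝ × Line)
  | .schr => Nonempty (L ≃ₗ⁅ℝ⁆ Schr)

/-- The six monomials `i, i a† a, g₊^(1,0), g₋^(1,0), g₊^(2,0), g₋^(2,0)`. -/
def fundamental : Set skewWeyl :=
  {imag, number, gPlus 1 0, gMinus 1 0, gPlus 2 0, gMinus 2 0}

/-- The vector space bases of the listed realizations of the given algebra. -/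
def Kind.bases : Kind → Set (Set skewWeyl)
  | .aff => {{gPlus 1 0, gMinus 2 0}, {gMinus 1 0, gMinus 2 0}}
  | .lineAff => {{imag, gPlus 1 0, gMinus 2 0}, {imag, gMinus 1 0, gMinus 2 0}}
  | .heis => {{imag, gPlus 1 0, gMinus 1 0}}
  | .sl2 => {{gPlus 2 0, gMinus 2 0, number + (1 / 2 : ℝ) • imag}}
  | .wh1 => {{imag, gPlus 1 0, gMinus 1 0, gPlus 2 0}, {imag, gPlus 1 0, gMinus 1 0, gMinus 2 0}}
  | .wh2 => {{imag, number, gPlus 1 0, gMinus 1 0}}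
  | .sl2Line => {{imag, number, gPlus 2 0, gMinus 2 0}}
  | .schr => {fundamental}

/-- The listed realizations of the given algebra, as Lie subalgebras of `Â₁`. -/
def Kind.realizations (k : Kind) : Set (LieSubalgebra ℝ skewWeyl) :=
  lieClosure '' k.bases

end SkewWeyl

end

open SkewWeyl

noncomputable section

namespace SkewWeyl

open Polynomial Module

/-! ### Normal ordering -/

/-! Filter `A₁` by the degree of normal-ordered monomials. A commutator of elements of degrees `s`
and `t` has degree at most `s + t - 2`, and its part of that degree is the Poisson bracket of the
two leading symbols (`lie_mem_filt_and_symb_lie`). Homogeneous symbols are dehomogenized to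
polynomials in one variable, so that a single monomial has a binomial `u X^b + v X^a` as its symbol.

In a finite-dimensional algebra the degrees are bounded. If `F` is a nonzero symbol of the top
degree `D ≥ 3`, its bracket with a symbol of degree `r ≥ 3` would have degree `D + r - 2 > D`, hence
vanishes. Symbols commuting with one nonzero symbol of nonzero degree commute with each other
(`br_eq_zero_of_common`), so all symbols of degree at least three Poisson commute
(`IsSymb.br_eq_zero`).

Suppose now that some generator `m` has degree `s ≥ 3`. Its symbol commutes with the symbols of
generators of degree at least three by the above. For a quadratic generator, the bracket with `m`
again has degree `s`, so it commutes with the symbol of `m`; for binomials this forces that bracket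
to vanish (`br_binom_quadratic`). For a linear generator, bracketing twice with `m` gives a symbol
of degree `2s - 3 ≥ 3` that does not commute with that of `m`, so no linear generator occurs
(`br_binom_linear`). Thus all generators have symbols commuting with that of `m`, hence with each
other. Commuting binomials are constant, both diagonal, or proportional (`binom_of_br_eq_zero`), and
in each case the monomials themselves commute (`lie_weylBinom_eq_zero`). So `𝔤` is abelian. In the
non-abelian case only the six monomials of degree at most two remain.

The rest is finite. The brackets of the six monomials decide which algebra a subset generates
(`exists_mem_bases`). Each listed span is the image of an injective homomorphism from the named
algebra (`Realizes.of_hom`), which gives closure under the bracket and the isomorphism together.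
Dimension, an eigenvalue condition and two conditions on the center separate the eight types; the
fundamental monomials that they contain separate the eleven subalgebras. -/

theorem normal_zero_zero : normal 0 0 = 1 := by simp [normal]

theorem ann_mul_cre_pow (p : ℕ) :
    ann * cre ^ p = cre ^ p * ann + (p : ℂ) • cre ^ (p - 1) := by
  induction p with
  | zero => simp
  | succ p ih =>
    rw [pow_succ, ← mul_assoc, ih, add_mul, mul_assoc, ann_mul_cre, mul_add, ← mul_assoc,
      smul_mul_assoc, ← pow_succ, mul_one, add_assoc]
    congr 1
    rcases p with _ | p
    · simp
    · rw [Nat.add_sub_cancel, ← pow_succ, Nat.add_sub_cancel]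
      push_cast
      module

theorem ann_mul_normal (p q : ℕ) :
    ann * normal p q = normal p (q + 1) + (p : ℂ) • normal (p - 1) q := by
  rw [normal, ← mul_assoc, ann_mul_cre_pow, add_mul, mul_assoc, ← pow_succ', smul_mul_assoc]
  rfl

/-- The action of `a†` on coefficients of normal-ordered polynomials. -/
def creOp : Module.End ℂ (ℕ × ℕ →₀ ℂ) :=
  Finsupp.lmapDomain ℂ ℂ fun x => (x.1 + 1, x.2)

/-- The action of `a` on coefficients of normal-ordered polynomials. -/
def annOp : Module.End ℂ (ℕ × ℕ →₀ ℂ) :=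
  Finsupp.linearCombination ℂ fun x =>
    Finsupp.single (x.1, x.2 + 1) (1 : ℂ) + Finsupp.single (x.1 - 1, x.2) (x.1 : ℂ)

theorem creOp_single (p q : ℕ) (c : ℂ) :
    creOp (Finsupp.single (p, q) c) = Finsupp.single (p + 1, q) c := by
  simp [creOp]

theorem annOp_single (p q : ℕ) (c : ℂ) :
    annOp (Finsupp.single (p, q) c) =
      Finsupp.single (p, q + 1) c + Finsupp.single (p - 1, q) (c * p) := by
  simp [annOp]

/-- The two operators satisfy the defining relation, so they give a representation of `A₁`. It
serves to prove that the normal-ordered monomials are linearly independent. -/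
theorem annOp_mul_creOp : annOp * creOp = creOp * annOp + 1 := by
  apply Finsupp.lhom_ext
  rintro ⟨p, q⟩ c
  rw [Module.End.mul_apply, LinearMap.add_apply, Module.End.mul_apply, Module.End.one_apply,
    creOp_single, annOp_single, annOp_single, map_add, creOp_single, creOp_single, add_assoc]
  congr 1
  rcases p with _ | p
  · simp
  · rw [Nat.add_sub_cancel, Nat.add_sub_cancel, ← Finsupp.single_add]
    congr 1
    push_cast
    ring

/-- Left multiplication of the Weyl algebra on coefficients of normal-ordered polynomials. -/
def normalRep : Weyl →ₐ[ℂ] Module.End ℂ (ℕ × ℕ →₀ ℂ) :=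
  RingQuot.liftAlgHom ℂ (s := CCR)
    ⟨FreeAlgebra.lift ℂ fun g => match g with
      | .lower => annOp
      | .raise => creOp, by
      rintro _ _ ⟨⟩
      simp only [map_mul, map_add, map_one, FreeAlgebra.lift_ι_apply]
      exact annOp_mul_creOp⟩

theorem normalRep_ann : normalRep ann = annOp := by
  unfold normalRep ann
  erw [RingQuot.liftAlgHom_mkAlgHom_apply]
  rw [FreeAlgebra.lift_ι_apply]

theorem normalRep_cre : normalRep cre = creOp := by
  unfold normalRep cre
  erw [RingQuot.liftAlgHom_mkAlgHom_apply]
  rw [FreeAlgebra.lift_ι_apply]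

/-- The coefficients of an element of the Weyl algebra with respect to the normal-ordered
monomials. -/
def normalCoeff : Weyl →ₗ[ℂ] (ℕ × ℕ →₀ ℂ) :=
  (LinearMap.applyₗ (Finsupp.single (0, 0) (1 : ℂ))).comp normalRep.toLinearMap

/-- Applied to the basis vector of the monomial `1`, the operator of `(a†)^p a^q` produces the basis
vector `(p, q)`: on `(0, q)` the derivative term of `annOp` has coefficient zero. This is the
independence half of the Poincaré–Birkhoff–Witt theorem. -/
theorem normalCoeff_normal (p q : ℕ) : normalCoeff (normal p q) = Finsupp.single (p, q) 1 := by
  have h1 : ∀ q : ℕ, (annOp ^ q) (Finsupp.single (0, 0) (1 : ℂ)) = Finsupp.single (0, q) 1 := by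
    intro q
    induction q with
    | zero => simp
    | succ q ih => rw [pow_succ', Module.End.mul_apply, ih, annOp_single]; simp
  have h2 : ∀ p : ℕ, (creOp ^ p) (Finsupp.single (0, q) (1 : ℂ)) = Finsupp.single (p, q) 1 := by
    intro p
    induction p with
    | zero => simp
    | succ p ih => rw [pow_succ', Module.End.mul_apply, ih, creOp_single]
  change normalRep (cre ^ p * ann ^ q) _ = _
  rw [map_mul, map_pow, map_pow, normalRep_ann, normalRep_cre, Module.End.mul_apply, h1, h2]

/-! ### The degree filtration -/

/-- The span of the normal-ordered monomials of degree at most `n`. -/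
def filt (n : ℤ) : Submodule ℂ Weyl :=
  Submodule.span ℂ ((fun x : ℕ × ℕ => normal x.1 x.2) '' {x | (x.1 : ℤ) + x.2 ≤ n})

theorem normal_mem_filt {p q : ℕ} {n : ℤ} (h : (p : ℤ) + q ≤ n) : normal p q ∈ filt n :=
  Submodule.subset_span ⟨(p, q), h, rfl⟩

theorem filt_mono {m n : ℤ} (h : m ≤ n) : filt m ≤ filt n :=
  Submodule.span_mono (Set.image_mono fun _ hx => le_trans hx h)

theorem filt_le_comap {n m : ℤ} (f : Weyl →ₗ[ℂ] Weyl)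
    (h : ∀ p q : ℕ, (p : ℤ) + q ≤ n → f (normal p q) ∈ filt m) {x : Weyl} (hx : x ∈ filt n) :
    f x ∈ filt m := by
  have : filt n ≤ (filt m).comap f := by
    rw [filt, Submodule.span_le]
    rintro _ ⟨⟨p, q⟩, hpq, rfl⟩
    exact h p q hpq
  exact this hx

theorem cre_pow_mul_mem_filt {n : ℤ} {x : Weyl} (hx : x ∈ filt n) (k : ℕ) :
    cre ^ k * x ∈ filt (n + k) := by
  refine filt_le_comap (LinearMap.mulLeft ℂ (cre ^ k)) (fun p q h => ?_) hx
  rw [LinearMap.mulLeft_apply, normal, ← mul_assoc, ← pow_add]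
  exact normal_mem_filt (by push_cast; omega)

theorem mul_ann_pow_mem_filt {n : ℤ} {x : Weyl} (hx : x ∈ filt n) (k : ℕ) :
    x * ann ^ k ∈ filt (n + k) := by
  refine filt_le_comap (LinearMap.mulRight ℂ (ann ^ k)) (fun p q h => ?_) hx
  rw [LinearMap.mulRight_apply, normal, mul_assoc, ← pow_add]
  exact normal_mem_filt (by push_cast; omega)

theorem smul_normal_mem_filt {c : ℂ} {p q : ℕ} {n : ℤ} (h : c ≠ 0 → (p : ℤ) + q ≤ n) :
    c • normal p q ∈ filt n := by
  by_cases hc : c = 0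
  · rw [hc, zero_smul]; exact zero_mem _
  · exact Submodule.smul_mem _ _ (normal_mem_filt (h hc))

theorem ann_mul_mem_filt {n : ℤ} {x : Weyl} (hx : x ∈ filt n) : ann * x ∈ filt (n + 1) := by
  refine filt_le_comap (LinearMap.mulLeft ℂ ann) (fun p q h => ?_) hx
  rw [LinearMap.mulLeft_apply, ann_mul_normal]
  refine add_mem (normal_mem_filt (by push_cast; omega)) (smul_normal_mem_filt fun hp => ?_)
  omega

/-- Normal ordering of `a^q (a†)^p` to second order. -/
theorem ann_pow_mul_cre_pow (p q : ℕ) :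
    ann ^ q * cre ^ p - normal p q - ((p : ℂ) * q) • normal (p - 1) (q - 1) ∈
      filt ((p : ℤ) + q - 4) := by
  induction q with
  | zero => simp [normal]
  | succ q ih =>
    have h := ann_mul_mem_filt ih
    -- Moving one more `a` through the two leading terms leaves only the second-order term with
    -- coefficient `p q (p - 1)`. When that coefficient is nonzero, no subtraction of exponents is
    -- truncated and the term has degree `p + q - 3`, exactly the allowed bound.
    have e : ann ^ (q + 1) * cre ^ p - normal p (q + 1)
        - ((p : ℂ) * (q + 1 : ℕ)) • normal (p - 1) (q + 1 - 1)
        = ann * (ann ^ q * cre ^ p - normal p q - ((p : ℂ) * q) • normal (p - 1) (q - 1))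
          + ((p : ℂ) * q * (p - 1 : ℕ)) • normal (p - 1 - 1) (q - 1) := by
      rw [mul_sub, mul_sub, ← mul_assoc, ← pow_succ', ann_mul_normal, mul_smul_comm,
        ann_mul_normal]
      rcases q with _ | q
      · simp [sub_sub]
      · simp only [Nat.add_sub_cancel]
        push_cast
        module
    rw [e]
    refine add_mem (filt_mono (by push_cast; omega) h) (smul_normal_mem_filt fun hp => ?_)
    have h1 : p ≠ 0 := by rintro rfl; simp at hp
    have h2 : q ≠ 0 := by rintro rfl; simp at hp
    have h3 : p - 1 ≠ 0 := by intro h; simp [h] at hp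
    push_cast
    omega

/-- The commutator of normal-ordered monomials to second order. -/
theorem lie_normal (p q p' q' : ℕ) :
    ⁅normal p q, normal p' q'⁆ -
      ((q : ℂ) * p' - p * q') • normal (p + p' - 1) (q + q' - 1) ∈
      filt ((p : ℤ) + q + p' + q' - 4) := by
  -- In a product the term of top degree is symmetric in the two factors, so it cancels in the
  -- commutator and only the difference of the next terms survives.
  have key : ∀ p q p' q' : ℕ, normal p q * normal p' q' - normal (p + p') (q + q')
      - ((p' : ℂ) * q) • normal (p + p' - 1) (q + q' - 1) ∈
      filt ((p : ℤ) + q + p' + q' - 4) := by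
    intro p q p' q'
    have h := mul_ann_pow_mem_filt (cre_pow_mul_mem_filt (ann_pow_mul_cre_pow p' q) p) q'
    have e : cre ^ p * (ann ^ q * cre ^ p' - normal p' q
        - ((p' : ℂ) * q) • normal (p' - 1) (q - 1)) * ann ^ q'
        = normal p q * normal p' q' - normal (p + p') (q + q')
      - ((p' : ℂ) * q) • normal (p + p' - 1) (q + q' - 1) := by
      rw [mul_sub, mul_sub, sub_mul, sub_mul, mul_smul_comm, smul_mul_assoc]
      congr 1
      · congr 1
        · simp only [normal, mul_assoc]
        · simp only [normal, mul_assoc, pow_add]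
      · rcases p' with _ | p'
        · simp
        rcases q with _ | q
        · simp
        congr 1
        rw [show p + (p' + 1) - 1 = p + p' by omega, show q + 1 + q' - 1 = q + q' by omega]
        simp only [normal, mul_assoc, pow_add, Nat.add_sub_cancel]
    rw [e] at h
    exact filt_mono (by omega) h
  have h1 := key p q p' q'
  have h2 := key p' q' p q
  rw [show (p' : ℤ) + q' + p + q - 4 = (p : ℤ) + q + p' + q' - 4 by ring,
    add_comm p' p, add_comm q' q] at h2
  have h3 := sub_mem h1 h2
  rw [Ring.lie_def]
  convert h3 using 1
  module

/-! ### Symbols -/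

/-- The homogeneous part of degree `n` of the normal symbol, dehomogenized: `(a†)^p a^q`
contributes `X ^ p`. -/
def symb (n : ℤ) : Weyl →ₗ[ℂ] ℂ[X] :=
  (Finsupp.linearCombination ℂ fun x : ℕ × ℕ =>
    if (x.1 : ℤ) + x.2 = n then (X : ℂ[X]) ^ x.1 else 0).comp normalCoeff

theorem symb_normal (n : ℤ) (p q : ℕ) :
    symb n (normal p q) = if (p : ℤ) + q = n then (X : ℂ[X]) ^ p else 0 := by
  simp [symb, normalCoeff_normal]

theorem symb_eq_zero {m n : ℤ} (h : m < n) {x : Weyl} (hx : x ∈ filt m) : symb n x = 0 := by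
  have : filt m ≤ LinearMap.ker (symb n) := by
    rw [filt, Submodule.span_le]
    rintro _ ⟨⟨p, q⟩, hpq, rfl⟩
    rw [Set.mem_ofPred_eq] at hpq
    simp only [SetLike.mem_coe, LinearMap.mem_ker, symb_normal]
    rw [if_neg]
    omega
  exact this hx

/-- The Poisson bracket of homogeneous symbols of degrees `s` and `t`, dehomogenized. -/
def br (s t : ℤ) (f g : ℂ[X]) : ℂ[X] :=
  (s : ℂ[X]) * f * derivative g - (t : ℂ[X]) * derivative f * g

/-- With `x = a†` and `y = a`, the bracket of homogeneous symbols is `F_y G_x - F_x G_y`. By Euler's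
identity, `F_y = s f - X f'` at `y = 1`, and likewise for `G`; the terms `X f' g'` cancel and `s f
g' - t f' g` remains. -/
theorem symb_lie_normal (p q p' q' : ℕ) :
    ⁅normal p q, normal p' q'⁆ ∈ filt ((p : ℤ) + q + p' + q' - 2) ∧
    symb ((p : ℤ) + q + p' + q' - 2) ⁅normal p q, normal p' q'⁆ =
      br ((p : ℤ) + q) ((p' : ℤ) + q') (X ^ p) (X ^ p') := by
  have h := lie_normal p q p' q'
  have hx : br ((p : ℤ) + q) ((p' : ℤ) + q') (X ^ p) (X ^ p') =
      ((q : ℂ) * p' - p * q') • X ^ (p + p' - 1) := by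
    rw [br, derivative_X_pow, derivative_X_pow, smul_eq_C_mul]
    simp only [map_sub, map_mul, map_natCast, Int.cast_add, Int.cast_natCast]
    rcases p with _ | p <;> rcases p' with _ | p'
    · simp
    · simp; ring
    · simp; ring
    · rw [show p + 1 + (p' + 1) - 1 = p + 1 + p' by omega]
      simp only [Nat.add_sub_cancel, pow_add]
      push_cast
      ring
  -- A nonzero coefficient excludes `p = p' = 0` and `q = q' = 0`, the cases in which the natural
  -- subtractions truncate.
  have hc : (q : ℂ) * p' - p * q' ≠ 0 →
      ((p + p' - 1 : ℕ) : ℤ) + (q + q' - 1 : ℕ) = (p : ℤ) + q + p' + q' - 2 := by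
    intro hc
    have h1 : p + p' ≠ 0 := by
      intro h
      apply hc
      rw [(by omega : p = 0), (by omega : p' = 0)]; simp
    have h2 : q + q' ≠ 0 := by
      intro h
      apply hc
      rw [(by omega : q = 0), (by omega : q' = 0)]; simp
    omega
  constructor
  · rw [← sub_add_cancel ⁅normal p q, normal p' q'⁆
      (((q : ℂ) * p' - p * q') • normal (p + p' - 1) (q + q' - 1))]
    exact add_mem (filt_mono (by omega) h) (smul_normal_mem_filt fun h => (hc h).le)
  · have h0 := symb_eq_zero (n := (p : ℤ) + q + p' + q' - 2) (by omega) h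
    rw [map_sub, sub_eq_zero] at h0
    rw [h0, hx, map_smul, symb_normal]
    by_cases h1 : (q : ℂ) * p' - p * q' = 0
    · rw [h1, zero_smul, zero_smul]
    · rw [if_pos (hc h1)]

theorem lie_complex_smul (c : ℂ) (x y : Weyl) : ⁅x, c • y⁆ = c • ⁅x, y⁆ := by
  simp only [Ring.lie_def, mul_smul_comm, smul_mul_assoc, smul_sub]

theorem complex_smul_lie (c : ℂ) (x y : Weyl) : ⁅c • x, y⁆ = c • ⁅x, y⁆ := by
  simp only [Ring.lie_def, mul_smul_comm, smul_mul_assoc, smul_sub]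

theorem br_add_left (s t : ℤ) (f f' g : ℂ[X]) : br s t (f + f') g = br s t f g + br s t f' g := by
  simp only [br, map_add]; ring

theorem br_add_right (s t : ℤ) (f g g' : ℂ[X]) : br s t f (g + g') = br s t f g + br s t f g' := by
  simp only [br, map_add]; ring

theorem br_smul_left (s t : ℤ) (c : ℂ) (f g : ℂ[X]) : br s t (c • f) g = c • br s t f g := by
  simp only [br, smul_eq_C_mul, derivative_C_mul]; ring

theorem br_smul_right (s t : ℤ) (c : ℂ) (f g : ℂ[X]) : br s t f (c • g) = c • br s t f g := by
  simp only [br, smul_eq_C_mul, derivative_C_mul]; ring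

theorem br_zero_left (s t : ℤ) (g : ℂ[X]) : br s t 0 g = 0 := by simp [br]

theorem br_zero_right (s t : ℤ) (f : ℂ[X]) : br s t f 0 = 0 := by simp [br]

/-- The symbol of a commutator is the Poisson bracket of the symbols. -/
theorem lie_mem_filt_and_symb_lie {s t : ℤ} {x y : Weyl} (hx : x ∈ filt s) (hy : y ∈ filt t) :
    ⁅x, y⁆ ∈ filt (s + t - 2) ∧ symb (s + t - 2) ⁅x, y⁆ = br s t (symb s x) (symb t y) := by
  rw [filt] at hx hy
  induction hx, hy using Submodule.span_induction₂ with
  | mem_mem x y hx hy =>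
    obtain ⟨⟨p, q⟩, hpq, rfl⟩ := hx
    obtain ⟨⟨p', q'⟩, hpq', rfl⟩ := hy
    rw [Set.mem_ofPred_eq] at hpq hpq'
    simp only at hpq hpq' ⊢
    obtain ⟨h1, h2⟩ := symb_lie_normal p q p' q'
    refine ⟨filt_mono (by omega) h1, ?_⟩
    rw [symb_normal, symb_normal]
    -- If either monomial lies strictly below its degree bound, its symbol is zero there, and the
    -- commutator lies strictly below `s + t - 2`.
    by_cases e : (p : ℤ) + q = s
    · by_cases e' : (p' : ℤ) + q' = t
      · rw [if_pos e, if_pos e', ← e, ← e', ← h2]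
        congr 2
        ring
      · rw [if_neg e', br_zero_right]
        exact symb_eq_zero (by omega) h1
    · rw [if_neg e, br_zero_left]
      exact symb_eq_zero (by omega) h1
  | zero_left y hy => simp [br_zero_left]
  | zero_right x hx => simp [br_zero_right]
  | add_left x y z hx hy hz h1 h2 =>
    rw [add_lie, map_add, map_add, br_add_left, h1.2, h2.2]
    exact ⟨add_mem h1.1 h2.1, rfl⟩
  | add_right x y z hx hy hz h1 h2 =>
    rw [lie_add, map_add, map_add, br_add_right, h1.2, h2.2]
    exact ⟨add_mem h1.1 h2.1, rfl⟩
  | smul_left r x y hx hy h =>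
    rw [complex_smul_lie, map_smul, map_smul, br_smul_left, h.2]
    exact ⟨Submodule.smul_mem _ _ h.1, rfl⟩
  | smul_right r x y hx hy h =>
    rw [lie_complex_smul, map_smul, map_smul, br_smul_right, h.2]
    exact ⟨Submodule.smul_mem _ _ h.1, rfl⟩

/-- Every element of the Weyl algebra lies in some step of the degree filtration. -/
theorem exists_mem_filt (x : Weyl) : ∃ n : ℕ, x ∈ filt n := by
  have hsmul : ∀ (c : ℂ) (x : Weyl), (∃ n : ℕ, x ∈ filt n) → ∃ n : ℕ, c • x ∈ filt n :=
    fun c x ⟨n, h⟩ => ⟨n, Submodule.smul_mem _ _ h⟩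
  have hadd : ∀ x y : Weyl, (∃ n : ℕ, x ∈ filt n) → (∃ n : ℕ, y ∈ filt n) →
      ∃ n : ℕ, x + y ∈ filt n := fun x y ⟨n, hn⟩ ⟨m, hm⟩ =>
    ⟨n + m, add_mem (filt_mono (by omega) hn) (filt_mono (by omega) hm)⟩
  have hcre : ∀ x : Weyl, (∃ n : ℕ, x ∈ filt n) → ∃ n : ℕ, cre * x ∈ filt n := fun x ⟨n, hn⟩ =>
    ⟨n + 1, by simpa using cre_pow_mul_mem_filt hn 1⟩
  have hann : ∀ x : Weyl, (∃ n : ℕ, x ∈ filt n) → ∃ n : ℕ, ann * x ∈ filt n := fun x ⟨n, hn⟩ =>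
    ⟨n + 1, by simpa using ann_mul_mem_filt hn⟩
  obtain ⟨w, rfl⟩ := RingQuot.mkAlgHom_surjective ℂ CCR x
  -- Left multiplication of an arbitrary `y` makes the induction pass through products: a word acts
  -- one generator at a time.
  suffices h : ∀ y : Weyl, (∃ n : ℕ, y ∈ filt n) →
      ∃ n : ℕ, (show Weyl from RingQuot.mkAlgHom ℂ CCR w) * y ∈ filt n by
    have := h 1 ⟨0, normal_zero_zero ▸ normal_mem_filt (by simp)⟩
    rwa [mul_one] at this
  induction w using FreeAlgebra.induction with
  | grade0 r =>
    intro y hy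
    rw [AlgHom.commutes]
    have := hsmul r y hy
    rwa [Algebra.smul_def] at this
  | grade1 g =>
    cases g with
    | lower => exact hann
    | raise => exact hcre
  | mul a b ha hb =>
    intro y hy
    rw [map_mul]
    have := ha _ (hb y hy)
    rwa [← mul_assoc] at this
  | add a b ha hb =>
    intro y hy
    rw [map_add]
    have := hadd _ _ (ha y hy) (hb y hy)
    rwa [← add_mul] at this

/-! ### Poisson brackets of binomials -/

/-- The binomial `u X^b + v X^a`. -/
def binom (u v : ℂ) (b a : ℕ) : ℂ[X] := C u * X ^ b + C v * X ^ a

theorem X_mul_derivative_binom (u v : ℂ) (b a : ℕ) :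
    X * derivative (binom u v b a) = C u * (b : ℂ[X]) * X ^ b + C v * (a : ℂ[X]) * X ^ a := by
  have h : ∀ n : ℕ, X * derivative (X ^ n : ℂ[X]) = (n : ℂ[X]) * X ^ n := by
    intro n
    rcases n with _ | n
    · simp
    · rw [derivative_X_pow, Nat.add_sub_cancel, map_natCast]; ring
  rw [binom, map_add, derivative_C_mul, derivative_C_mul]
  linear_combination C u * h b + C v * h a

/-- The factor `X` turns derivatives into the Euler operator `X d/dX`, which is diagonal on powers.
No exponent is lowered, so the cases of exponent zero need no separate treatment. -/
theorem X_mul_br_binom (s t : ℤ) (u v u' v' : ℂ) (b a b' a' : ℕ) :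
    X * br s t (binom u v b a) (binom u' v' b' a') =
      C (u * u' * (s * b' - t * b)) * X ^ (b + b') +
      C (u * v' * (s * a' - t * b)) * X ^ (b + a') +
      C (v * u' * (s * b' - t * a)) * X ^ (a + b') +
      C (v * v' * (s * a' - t * a)) * X ^ (a + a') := by
  have h1 := X_mul_derivative_binom u v b a
  have h2 := X_mul_derivative_binom u' v' b' a'
  have h3 : X * br s t (binom u v b a) (binom u' v' b' a') =
      (s : ℂ[X]) * binom u v b a * (X * derivative (binom u' v' b' a')) -
      (t : ℂ[X]) * (X * derivative (binom u v b a)) * binom u' v' b' a' := by rw [br]; ring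
  rw [h3, h1, h2]
  simp only [binom, map_mul, map_sub, map_natCast, map_intCast]
  ring

theorem coeff_X_mul_br_binom (s t : ℤ) (u v u' v' : ℂ) (b a b' a' n : ℕ) :
    (X * br s t (binom u v b a) (binom u' v' b' a')).coeff n =
      (if n = b + b' then u * u' * (s * b' - t * b) else 0) +
      (if n = b + a' then u * v' * (s * a' - t * b) else 0) +
      (if n = a + b' then v * u' * (s * b' - t * a) else 0) +
      (if n = a + a' then v * v' * (s * a' - t * a) else 0) := by
  rw [X_mul_br_binom]
  simp only [coeff_add, coeff_C_mul, coeff_X_pow, mul_ite, mul_one, mul_zero]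

/-- The classification of Poisson commuting binomial symbols. -/
theorem binom_of_br_eq_zero {u v u' v' : ℂ} {b a b' a' : ℕ} (hab : b ≤ a) (hab' : b' ≤ a')
    (hv : v ≠ 0) (hu' : u' ≠ 0) (hv' : v' ≠ 0) (huv : b = a → u + v ≠ 0)
    (huv' : b' = a' → u' + v' ≠ 0)
    (h : br ((a : ℤ) + b) ((a' : ℤ) + b') (binom u v b a) (binom u' v' b' a') = 0) :
    a = 0 ∨ a' = 0 ∨ (a = b ∧ a' = b') ∨ (a = a' ∧ b = b' ∧ u * v' = v * u') := by
  have hn : ∀ n, (X * br ((a : ℤ) + b) ((a' : ℤ) + b') (binom u v b a)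
    (binom u' v' b' a')).coeff n = 0 := by simp [h]
  simp only [coeff_X_mul_br_binom] at hn
  push_cast at hn
  rcases hab.eq_or_lt with e | e <;> rcases hab'.eq_or_lt with e' | e'
  · exact Or.inr (Or.inr (Or.inl ⟨e.symm, e'.symm⟩))
  · subst e
    left
    -- The first symbol is `(u + v) X^b`, so the second and fourth terms merge at this exponent.
    have h1 := hn (b + a')
    rw [if_neg (by omega), if_pos rfl, if_neg (by omega), if_pos rfl] at h1
    have h2 : (u + v) * v' * (b * (a' - b' : ℂ)) = 0 := by linear_combination h1
    have h3 : (a' : ℂ) - b' ≠ 0 := by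
      rw [sub_ne_zero]; exact_mod_cast e'.ne'
    simpa [huv rfl, hv', h3] using h2
  · subst e'
    right; left
    have h1 := hn (a + b')
    rw [if_neg (by omega), if_neg (by omega), if_pos rfl, if_pos rfl] at h1
    have h2 : (u' + v') * v * (b' * (b - a : ℂ)) = 0 := by linear_combination h1
    have h3 : (b : ℂ) - a ≠ 0 := by
      rw [sub_ne_zero]; exact_mod_cast e.ne
    simpa [huv' rfl, hv, h3] using h2
  · right; right; right
    -- The top coefficient gives `b a' = a b'`: the exponent pairs are proportional.
    have h1 := hn (a + a')
    rw [if_neg (by omega), if_neg (by omega), if_neg (by omega), if_pos rfl] at h1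
    have h2 : (v * v') * (b * a' - a * b' : ℂ) = 0 := by linear_combination h1
    have h3 : b * a' = a * b' := by
      have := (mul_eq_zero.1 h2).resolve_left (mul_ne_zero hv hv')
      rw [sub_eq_zero] at this
      exact_mod_cast this
    have h4 : (a : ℂ) * a' - b * b' ≠ 0 := by
      rw [sub_ne_zero]
      have : b * b' < a * a' := by nlinarith
      exact_mod_cast this.ne'
    have h5 := hn (a + b')
    rw [if_neg (c := a + b' = b + b') (by omega), if_pos (c := a + b' = a + b') rfl,
      if_neg (c := a + b' = a + a') (by omega)] at h5
    -- The two mixed terms share an exponent exactly when `a - b = a' - b'`. Proportionality then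
    -- makes the pairs equal, and the coefficient compares `u v'` with `v u'`. Otherwise the term at
    -- `a + b'` stands alone and is nonzero.
    by_cases e2 : a + b' = b + a'
    · rw [if_pos e2] at h5
      obtain ⟨l, rfl⟩ := Nat.exists_eq_add_of_lt e
      obtain rfl : a' = b' + l + 1 := by omega
      have h6 : b = b' := by
        have : (l + 1) * b = (l + 1) * b' := by linarith
        exact Nat.eq_of_mul_eq_mul_left (by omega) this
      refine ⟨by omega, h6, ?_⟩
      have h7 : (u * v' - v * u') * (((b + l + 1 : ℕ) : ℂ) * ((b' + l + 1 : ℕ) : ℂ) - b * b') = 0 := by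
        push_cast at h5 ⊢
        linear_combination h5
      exact sub_eq_zero.1 ((mul_eq_zero.1 h7).resolve_right h4)
    · rw [if_neg e2] at h5
      have : (v * u') * ((a : ℂ) * a' - b * b') = 0 := by linear_combination -h5
      exact absurd this (mul_ne_zero (mul_ne_zero hv hu') h4)

/-- The Poisson bracket of leading terms. -/
theorem natDegree_br_le_and_coeff_br {s t : ℤ} {f g : ℂ[X]} {p q n : ℕ} (hf : f.natDegree ≤ p)
    (hg : g.natDegree ≤ q) (hn : p + q = n + 1) :
    (br s t f g).natDegree ≤ n ∧
      (br s t f g).coeff n = (s * q - t * p) * (f.coeff p * g.coeff q) := by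
  -- The Euler operator keeps the degree bound `k` and multiplies the coefficient there by `k`, so
  -- leading coefficients can be multiplied as usual.
  have hd : ∀ {h : ℂ[X]} {k : ℕ}, h.natDegree ≤ k →
      (X * derivative h).natDegree ≤ k ∧ (X * derivative h).coeff k = k * h.coeff k := by
    intro h k hk
    constructor
    · rcases k with _ | k
      · rw [eq_C_of_natDegree_le_zero hk]
        simp
      · have h1 := natDegree_derivative_le h
        have h2 : (X * derivative h).natDegree ≤ (X : ℂ[X]).natDegree + (derivative h).natDegree :=
          natDegree_mul_le
        rw [natDegree_X] at h2
        omega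
    · rcases k with _ | k
      · simp
      · rw [coeff_X_mul, coeff_derivative]; push_cast; ring
  obtain ⟨hf1, hf2⟩ := hd hf
  obtain ⟨hg1, hg2⟩ := hd hg
  have e : X * br s t f g = C (s : ℂ) * (f * (X * derivative g)) - C (t : ℂ) * ((X * derivative f) * g) := by
    rw [br, map_intCast, map_intCast]; ring
  constructor
  · have h1 : (X * br s t f g).natDegree ≤ p + q := by
      rw [e]
      refine (natDegree_sub_le _ _).trans (max_le ?_ ?_)
      · exact (natDegree_C_mul_le _ _).trans (natDegree_mul_le_of_le hf hg1)
      · exact (natDegree_C_mul_le _ _).trans (natDegree_mul_le_of_le hf1 hg)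
    by_cases h0 : br s t f g = 0
    · rw [h0]; simp
    · rw [natDegree_X_mul h0] at h1
      omega
  · rw [← coeff_X_mul, ← hn, e, coeff_sub, coeff_C_mul, coeff_C_mul,
      coeff_mul_add_eq_of_natDegree_le hf hg1, coeff_mul_add_eq_of_natDegree_le hf1 hg, hf2, hg2]
    ring

theorem natDegree_binom_le {u v : ℂ} {b a : ℕ} (hab : b ≤ a) : (binom u v b a).natDegree ≤ a := by
  refine (natDegree_add_le _ _).trans (max_le ?_ ?_)
  · exact (natDegree_C_mul_X_pow_le _ _).trans hab
  · exact natDegree_C_mul_X_pow_le _ _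

theorem coeff_binom_ne_zero {u v : ℂ} {b a : ℕ} (hv : v ≠ 0) (huv : b = a → u + v ≠ 0) :
    (binom u v b a).coeff a ≠ 0 := by
  simp only [binom, coeff_add, coeff_C_mul, coeff_X_pow]
  by_cases h : a = b
  · simpa [h] using huv h.symm
  · simpa [h] using hv

theorem br_binom_eq (s t : ℤ) {u v u' v' : ℂ} {b a b' a' : ℕ} {w z : ℂ} {c d : ℕ}
    (h : C (u * u' * (s * b' - t * b)) * X ^ (b + b') +
      C (u * v' * (s * a' - t * b)) * X ^ (b + a') +
      C (v * u' * (s * b' - t * a)) * X ^ (a + b') +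
      C (v * v' * (s * a' - t * a)) * X ^ (a + a') =
      (C w * X ^ (c + 1) + C z * X ^ (d + 1) : ℂ[X])) :
    br s t (binom u v b a) (binom u' v' b' a') = binom w z c d := by
  apply mul_left_cancel₀ (X_ne_zero (R := ℂ))
  rw [X_mul_br_binom, h, binom]
  ring

/-- A monomial symbol of degree at least three that commutes with its bracket with a quadratic
monomial symbol commutes with the latter. -/
theorem br_binom_quadratic {u v u' v' : ℂ} {b a b' a' : ℕ} (hab : b ≤ a) (hab' : b' ≤ a')
    (hu : u ≠ 0) (hv : v ≠ 0) (hv' : v' ≠ 0) (huv : b = a → u + v ≠ 0)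
    (huv' : b' = a' → u' + v' ≠ 0) (hs : 3 ≤ a + b) (ht : a' + b' = 2)
    (h : br ((a : ℤ) + b) ((a : ℤ) + b) (binom u v b a)
      (br ((a : ℤ) + b) 2 (binom u v b a) (binom u' v' b' a')) = 0) :
    br ((a : ℤ) + b) 2 (binom u v b a) (binom u' v' b' a') = 0 := by
  obtain ⟨rfl, rfl⟩ | ⟨rfl, rfl⟩ : (b' = 1 ∧ a' = 1) ∨ (b' = 0 ∧ a' = 2) := by omega
  · have hw := huv' rfl
    -- The symbol of `N` multiplies `X^b` and `X^a` by opposite factors. In the bracket with the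
    -- original binomial the two mixed terms then add up, to a multiple of `(a - b)²`; so `a = b`,
    -- where the present bracket is zero.
    have hy : br ((a : ℤ) + b) 2 (binom u v b a) (binom u' v' 1 1) =
        binom (u * (u' + v') * (a - b)) (v * (u' + v') * (b - a)) b a := by
      apply br_binom_eq
      push_cast
      simp only [map_mul, map_add, map_sub, map_natCast, map_one, C_ofNat]
      ring
    have h1 := coeff_X_mul_br_binom ((a : ℤ) + b) ((a : ℤ) + b) u v
      (u * (u' + v') * (a - b)) (v * (u' + v') * (b - a)) b a b a (a + b)
    rw [hy] at h ⊢
    rw [h, mul_zero, coeff_zero] at h1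
    rcases hab.eq_or_lt with rfl | e
    · simp [binom]
    · rw [if_neg (by omega), if_pos (by omega), if_pos rfl, if_neg (by omega)] at h1
      push_cast at h1
      have h2 : (2 * u * v * (u' + v')) * ((a : ℂ) + b) * ((a - b) * (a - b)) = 0 := by
        linear_combination h1
      have h3 : (a : ℂ) + b ≠ 0 := by
        have : a + b ≠ 0 := by omega
        exact_mod_cast this
      have h4 : (a : ℂ) - b ≠ 0 := by
        rw [sub_ne_zero]; exact_mod_cast e.ne'
      simp [hu, hv, hw, h3, h4] at h2
  · exfalso
    -- For `b = 0` the lowest coefficient of the double bracket is a nonzero multiple of `u² v'`.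
    -- For `b > 0` its leading coefficient has the factor `2 b (a + b)`.
    by_cases hb : b = 0
    · subst hb
      have hy : br ((a : ℤ) + (0 : ℕ)) 2 (binom u v 0 a) (binom u' v' 0 2) =
          binom (2 * a * u * v') (- (2 * a * v * u')) 1 (a - 1) := by
        apply br_binom_eq
        rw [show a - 1 + 1 = a by omega]
        push_cast
        simp only [map_mul, map_add, map_sub, map_neg, map_natCast, map_zero, C_ofNat]
        ring
      rw [hy] at h
      have h1 := coeff_X_mul_br_binom ((a : ℤ) + (0 : ℕ)) ((a : ℤ) + (0 : ℕ)) u v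
        (2 * a * u * v') (- (2 * a * v * u')) 0 a 1 (a - 1) 1
      rw [h, mul_zero, coeff_zero, if_pos rfl, if_neg (by omega), if_neg (by omega),
        if_neg (by omega)] at h1
      have ha : a ≠ 0 := by omega
      simp [hu, hv', ha] at h1
    · obtain ⟨h1, h2⟩ := natDegree_br_le_and_coeff_br (s := (a : ℤ) + b) (t := 2) (n := a + 1)
        (natDegree_binom_le (u := u) (v := v) hab) (natDegree_binom_le (u := u') (v := v') hab')
        (by omega)
      obtain ⟨-, h3⟩ := natDegree_br_le_and_coeff_br (s := (a : ℤ) + b) (t := (a : ℤ) + b)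
        (n := 2 * a) (natDegree_binom_le (u := u) (v := v) hab) h1 (by omega)
      have hf := coeff_binom_ne_zero hv huv
      have hg := coeff_binom_ne_zero hv' huv'
      rw [h, h2, coeff_zero] at h3
      push_cast at h3
      have h4 : ((a : ℂ) + b) * (2 * b) * ((binom u v b a).coeff a * ((binom u v b a).coeff a *
        (binom u' v' 0 2).coeff 2)) = 0 := by linear_combination -h3
      have h5 : (a : ℂ) + b ≠ 0 := by
        have : a + b ≠ 0 := by omega
        exact_mod_cast this
      simp [hf, hg, h5, hb] at h4

/-- The third iterated bracket of a monomial symbol of degree at least three with a linear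
monomial symbol does not vanish. -/
theorem br_binom_linear {u v u' v' : ℂ} {b a : ℕ} (hab : b ≤ a)
    (hu : u ≠ 0) (hv : v ≠ 0) (hu' : u' ≠ 0) (hv' : v' ≠ 0) (huv : b = a → u + v ≠ 0)
    (hs : 3 ≤ a + b) :
    br ((a : ℤ) + b) (2 * ((a : ℤ) + b) - 3) (binom u v b a)
      (br ((a : ℤ) + b) ((a : ℤ) + b - 1) (binom u v b a)
        (br ((a : ℤ) + b) 1 (binom u v b a) (binom u' v' 0 1))) ≠ 0 := by
  intro h
  -- For `b = 0` the leading coefficient `(2a - b) a b` used in the other case vanishes, so the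
  -- lowest coefficient is taken instead; `a ≥ 3` makes it nonzero.
  by_cases hb : b = 0
  · subst hb
    have hy : br ((a : ℤ) + (0 : ℕ)) 1 (binom u v 0 a) (binom u' v' 0 1) =
        binom (a * u * v') (- (a * v * u')) 0 (a - 1) := by
      apply br_binom_eq
      rw [show a - 1 + 1 = a by omega]
      push_cast
      simp only [map_mul, map_add, map_sub, map_neg, map_natCast, map_zero, map_one]
      ring
    have hy2 : br ((a : ℤ) + (0 : ℕ)) ((a : ℤ) + (0 : ℕ) - 1) (binom u v 0 a)
        (binom (a * u * v') (- (a * v * u')) 0 (a - 1)) =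
        binom (- (a * a * (a - 1) * u * v * u')) (- (a * a * (a - 1) * u * v * v'))
          (a - 2) (a - 1) := by
      apply br_binom_eq
      rw [show a - 1 + 1 = a by omega, show a - 2 + 1 = a - 1 by omega,
        Nat.cast_sub (by omega : 1 ≤ a)]
      push_cast
      simp only [map_mul, map_add, map_sub, map_neg, map_natCast, map_zero, map_one]
      ring
    rw [hy, hy2] at h
    have h1 := coeff_X_mul_br_binom ((a : ℤ) + (0 : ℕ)) (2 * ((a : ℤ) + (0 : ℕ)) - 3) u v
      (- (a * a * (a - 1) * u * v * u')) (- (a * a * (a - 1) * u * v * v')) 0 a (a - 2) (a - 1)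
      (a - 2)
    rw [h, mul_zero, coeff_zero, if_pos (by omega), if_neg (by omega), if_neg (by omega),
      if_neg (by omega)] at h1
    have ha : a ≠ 0 := by omega
    have ha1 : (a : ℂ) - 1 ≠ 0 := by
      rw [sub_ne_zero]
      have : a ≠ 1 := by omega
      exact_mod_cast this
    have ha2 : ((a - 2 : ℕ) : ℂ) ≠ 0 := by
      have : a - 2 ≠ 0 := by omega
      exact_mod_cast this
    simp [hu, hv, hu', ha, ha1, ha2, -Nat.cast_sub] at h1
  · obtain ⟨h1, h2⟩ := natDegree_br_le_and_coeff_br (s := (a : ℤ) + b) (t := 1) (n := a)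
      (natDegree_binom_le (u := u) (v := v) hab)
      (natDegree_binom_le (u := u') (v := v') zero_le_one) (by omega)
    obtain ⟨h3, h4⟩ := natDegree_br_le_and_coeff_br (s := (a : ℤ) + b) (t := (a : ℤ) + b - 1)
      (n := 2 * a - 1) (natDegree_binom_le (u := u) (v := v) hab) h1 (by omega)
    obtain ⟨-, h5⟩ := natDegree_br_le_and_coeff_br (s := (a : ℤ) + b)
      (t := 2 * ((a : ℤ) + b) - 3)
      (n := 3 * a - 2) (natDegree_binom_le (u := u) (v := v) hab) h3 (by omega)
    have hf := coeff_binom_ne_zero hv huv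
    have hg := coeff_binom_ne_zero (u := u') (b := 0) (a := 1) hv' (by simp)
    rw [h, h4, h2, coeff_zero, Nat.cast_sub (by omega : 1 ≤ 2 * a)] at h5
    push_cast at h5
    set F := (binom u v b a).coeff a
    have h6 : (2 * a - b : ℂ) * a * b * (F * (F * (F * (binom u' v' 0 1).coeff 1))) = 0 := by
      linear_combination -h5
    have h7 : (2 * a - b : ℂ) ≠ 0 := by
      rw [sub_ne_zero]
      have : 2 * a ≠ b := by omega
      exact_mod_cast this
    have h8 : a ≠ 0 := by omega
    simp [hf, hg, h7, h8, hb] at h6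

/-- Symbols commuting with a common nonzero symbol commute. -/
theorem br_eq_zero_of_common {d s t : ℤ} {f g h : ℂ[X]} (hd : d ≠ 0) (hf : f ≠ 0)
    (hg : br d s f g = 0) (hh : br d t f h = 0) : br s t g h = 0 := by
  have hd' : (d : ℂ[X]) ≠ 0 := by exact_mod_cast hd
  apply mul_left_cancel₀ (mul_ne_zero hd' hf)
  rw [mul_zero]
  rw [br] at hg hh ⊢
  -- The hypotheses say `d f g' = s f' g` and `d f h' = t f' h`; after multiplication by `d f` both
  -- terms of the bracket become `s t f' g h`.
  linear_combination s * g * hh - t * h * hg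

/-! ### Monomials and their symbols -/

/-- The element of the Weyl algebra with the binomial symbol `u X^b + v X^a`. -/
def weylBinom (u v : ℂ) (b a : ℕ) : Weyl := u • normal b a + v • normal a b

theorem weylBinom_mem_filt (u v : ℂ) (b a : ℕ) : weylBinom u v b a ∈ filt ((a : ℤ) + b) :=
  add_mem (Submodule.smul_mem _ _ (normal_mem_filt (by omega)))
    (Submodule.smul_mem _ _ (normal_mem_filt le_rfl))

theorem symb_weylBinom (u v : ℂ) (b a : ℕ) :
    symb ((a : ℤ) + b) (weylBinom u v b a) = binom u v b a := by
  rw [weylBinom, map_add, map_smul, map_smul, symb_normal, symb_normal, if_pos (by omega),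
    if_pos rfl, binom, smul_eq_C_mul, smul_eq_C_mul]

theorem gPlus_zero_zero : gPlus 0 0 = (2 : ℝ) • imag := by
  apply Subtype.ext
  change Complex.I • (normal 0 0 + normal 0 0) = (2 : ℝ) • (Complex.I • (1 : Weyl))
  rw [normal_zero_zero]
  module

theorem gPlus_one_one : gPlus 1 1 = (2 : ℝ) • number := by
  apply Subtype.ext
  change Complex.I • (normal 1 1 + normal 1 1) = (2 : ℝ) • (Complex.I • (cre * ann))
  rw [show normal 1 1 = cre * ann by simp [normal]]
  module

/-- Monomials have binomial symbols, and those of degree at most two are multiples of fundamental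
ones. -/
theorem IsMonomial.exists_weylBinom {x : skewWeyl} (hx : IsMonomial x) :
    ∃ (u v : ℂ) (b a : ℕ), b ≤ a ∧ u ≠ 0 ∧ v ≠ 0 ∧ (b = a → u + v ≠ 0) ∧
      (x : Weyl) = weylBinom u v b a ∧
      (a + b < 3 → ∃ c : ℝ, c ≠ 0 ∧ ∃ y ∈ fundamental, x = c • y) := by
  obtain ⟨c, hc, α, β, ⟨h, rfl⟩ | ⟨h, rfl⟩⟩ := hx
  · have hc' : (c : ℂ) * Complex.I ≠ 0 :=
      mul_ne_zero (Complex.ofReal_ne_zero.2 hc) Complex.I_ne_zero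
    refine ⟨c * Complex.I, c * Complex.I, β, α, h, hc', hc', fun _ => ?_, ?_, fun hlt => ?_⟩
    · rw [← two_mul]
      exact mul_ne_zero two_ne_zero hc'
    · change c • (Complex.I • (normal β α + normal α β)) = _
      rw [weylBinom, ← Complex.coe_smul, smul_smul, smul_add]
    · have hc2 : c * 2 ≠ 0 := mul_ne_zero hc two_ne_zero
      obtain ⟨rfl, rfl⟩ | ⟨rfl, rfl⟩ | ⟨rfl, rfl⟩ | ⟨rfl, rfl⟩ : (α = 0 ∧ β = 0) ∨
        (α = 1 ∧ β = 0) ∨ (α = 2 ∧ β = 0) ∨ (α = 1 ∧ β = 1) := by omega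
      · exact ⟨c * 2, hc2, imag, by simp [fundamental], by rw [gPlus_zero_zero, smul_smul]⟩
      · exact ⟨c, hc, _, by simp [fundamental], rfl⟩
      · exact ⟨c, hc, _, by simp [fundamental], rfl⟩
      · exact ⟨c * 2, hc2, number, by simp [fundamental], by rw [gPlus_one_one, smul_smul]⟩
  · have hc' : (c : ℂ) ≠ 0 := Complex.ofReal_ne_zero.2 hc
    refine ⟨c, -c, β, α, h.le, hc', neg_ne_zero.2 hc', fun e => absurd e h.ne, ?_, fun hlt => ?_⟩
    · change c • (normal β α - normal α β) = _
      rw [weylBinom, ← Complex.coe_smul, smul_sub, neg_smul, sub_eq_add_neg]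
    · obtain ⟨rfl, rfl⟩ | ⟨rfl, rfl⟩ : (α = 1 ∧ β = 0) ∨ (α = 2 ∧ β = 0) := by omega
      · exact ⟨c, hc, _, by simp [fundamental], rfl⟩
      · exact ⟨c, hc, _, by simp [fundamental], rfl⟩

/-! ### Commutation of diagonal monomials -/

theorem ann_pow_mul_cre (q : ℕ) :
    ann ^ q * cre = cre * ann ^ q + (q : ℂ) • ann ^ (q - 1) := by
  induction q with
  | zero => simp
  | succ q ih =>
    rw [pow_succ', mul_assoc, ih, mul_add, ← mul_assoc, ann_mul_cre, add_mul, one_mul,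
      mul_smul_comm, ← pow_succ', mul_assoc, ← pow_succ', add_assoc]
    congr 1
    rcases q with _ | q
    · simp
    · rw [Nat.add_sub_cancel, Nat.add_sub_cancel]
      push_cast
      module

/-- This recursion exhibits `(a†)^n a^n` as a polynomial in `a† a`, which is why diagonal monomials
commute. -/
theorem normal_diag_succ (n : ℕ) :
    normal (n + 1) (n + 1) = normal n n * (cre * ann) - (n : ℂ) • normal n n := by
  rw [eq_sub_iff_add_eq, normal, normal, mul_assoc (cre ^ n), ← mul_assoc (ann ^ n),
    ann_pow_mul_cre, add_mul, mul_add, smul_mul_assoc, mul_smul_comm]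
  congr 1
  · simp only [pow_succ, mul_assoc]
  · rcases n with _ | n
    · simp
    · rw [Nat.add_sub_cancel, ← pow_succ]

theorem commute_normal_diag {x : Weyl} (hx : Commute x (cre * ann)) (n : ℕ) :
    Commute x (normal n n) := by
  induction n with
  | zero => rw [normal_zero_zero]; exact Commute.one_right x
  | succ n ih =>
    rw [normal_diag_succ]
    exact (ih.mul_right hx).sub_right (ih.smul_right _)

theorem commute_normal_diag_normal_diag (m n : ℕ) : Commute (normal m m) (normal n n) :=
  commute_normal_diag (commute_normal_diag (Commute.refl _) m).symm n

/-- Two monomials commute as soon as their symbols Poisson commute. -/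
theorem lie_weylBinom_eq_zero {u v u' v' : ℂ} {b a b' a' : ℕ} (hab : b ≤ a) (hab' : b' ≤ a')
    (hv : v ≠ 0) (hu' : u' ≠ 0) (hv' : v' ≠ 0) (huv : b = a → u + v ≠ 0)
    (huv' : b' = a' → u' + v' ≠ 0)
    (h : br ((a : ℤ) + b) ((a' : ℤ) + b') (binom u v b a) (binom u' v' b' a') = 0) :
    ⁅weylBinom u v b a, weylBinom u' v' b' a'⁆ = 0 := by
  rw [← commute_iff_lie_eq]
  have hdiag : ∀ (u v : ℂ) (n : ℕ), weylBinom u v n n = (u + v) • normal n n := fun u v n => by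
    rw [weylBinom, add_smul]
  have hscalar : ∀ (u v : ℂ) (x : Weyl), Commute (weylBinom u v 0 0) x := fun u v x => by
    rw [hdiag, normal_zero_zero]
    exact (Commute.one_left x).smul_left _
  rcases binom_of_br_eq_zero hab hab' hv hu' hv' huv huv' h with rfl | rfl | ⟨rfl, rfl⟩ |
    ⟨rfl, rfl, e⟩
  · obtain rfl : b = 0 := by omega
    exact hscalar _ _ _
  · obtain rfl : b' = 0 := by omega
    exact (hscalar _ _ _).symm
  · rw [hdiag, hdiag]
    exact ((commute_normal_diag_normal_diag _ _).smul_left _).smul_right _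
  -- Proportional symbols of monomials come from proportional monomials, since the coefficients of
  -- the symbol determine the element.
  · have e' : weylBinom u v b a = (v / v') • weylBinom u' v' b a := by
      rw [weylBinom, weylBinom, smul_add, smul_smul, smul_smul]
      congr 2
      · field_simp; linear_combination e
      · field_simp
    rw [e']
    exact (Commute.refl _).smul_left _

/-! ### Symbols of a Lie subalgebra -/

/-- `f` is the symbol of degree `s` of an element of `g`. -/
def IsSymb (g : LieSubalgebra ℝ skewWeyl) (s : ℤ) (f : ℂ[X]) : Prop :=
  ∃ y ∈ g, (y : Weyl) ∈ filt s ∧ symb s (y : Weyl) = f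

/-- The zero polynomial counts as a symbol in every degree, so cancellation of leading terms needs
no separate case. -/
theorem IsSymb.br {g : LieSubalgebra ℝ skewWeyl} {s t : ℤ} {f h : ℂ[X]} (hf : IsSymb g s f)
    (hh : IsSymb g t h) : IsSymb g (s + t - 2) (br s t f h) := by
  obtain ⟨x, hx, hxs, rfl⟩ := hf
  obtain ⟨y, hy, hyt, rfl⟩ := hh
  obtain ⟨h1, h2⟩ := lie_mem_filt_and_symb_lie hxs hyt
  exact ⟨⁅x, y⁆, g.lie_mem hx hy, h1, h2⟩

theorem exists_forall_mem_filt (g : LieSubalgebra ℝ skewWeyl) [FiniteDimensional ℝ g] :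
    ∃ N : ℕ, ∀ y ∈ g, (y : Weyl) ∈ filt N := by
  have hg : g.toSubmodule.FG := Module.Finite.iff_fg.1 ‹FiniteDimensional ℝ g›
  obtain ⟨S, hS⟩ := hg
  choose n hn using fun y : skewWeyl => exists_mem_filt (y : Weyl)
  refine ⟨S.sup n, fun y hy => ?_⟩
  have hy' : y ∈ Submodule.span ℝ (S : Set skewWeyl) := by rw [hS]; exact hy
  induction hy' using Submodule.span_induction with
  | mem x hx => exact filt_mono (by exact_mod_cast Finset.le_sup hx) (hn x)
  | zero => exact zero_mem _
  | add x y hx hz h1 h2 =>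
    exact add_mem (h1 (hS.le hx)) (h2 (hS.le hz))
  | smul c x hx h =>
    change c • (x : Weyl) ∈ _
    rw [← Complex.coe_smul]
    exact Submodule.smul_mem _ _ (h (hS.le hx))

/-- In a finite-dimensional Lie subalgebra, all symbols of degree at least three Poisson commute. -/
theorem IsSymb.br_eq_zero {g : LieSubalgebra ℝ skewWeyl} [FiniteDimensional ℝ g] {s t : ℤ}
    {f h : ℂ[X]} (hf : IsSymb g s f) (hh : IsSymb g t h) (hs : 3 ≤ s) (ht : 3 ≤ t) :
    SkewWeyl.br s t f h = 0 := by
  classical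
  by_cases hf0 : f = 0
  · rw [hf0, br_zero_left]
  obtain ⟨N, hN⟩ := exists_forall_mem_filt g
  have hbound : ∀ (r : ℤ) (k : ℂ[X]), k ≠ 0 → IsSymb g r k → r ≤ N := by
    rintro r k hk ⟨y, hy, -, rfl⟩
    by_contra hr
    exact hk (symb_eq_zero (by omega) (hN y hy))
  lift s to ℕ using by omega
  -- `D` is the largest degree carrying a nonzero symbol `F`, and `D ≥ s ≥ 3`. A nonzero bracket of
  -- `F` with a symbol of degree `r ≥ 3` would have degree `D + r - 2 > D`.
  let P : ℕ → Prop := fun d => ∃ k : ℂ[X], k ≠ 0 ∧ IsSymb g d k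
  have hPs : P s := ⟨f, hf0, hf⟩
  have hsN : s ≤ N := by exact_mod_cast hbound s f hf0 hf
  obtain ⟨F, hF0, hF⟩ := Nat.findGreatest_spec hsN hPs
  have hsD := Nat.le_findGreatest hsN hPs
  set D := Nat.findGreatest P N
  have htop : ∀ (r : ℤ) (k : ℂ[X]), 3 ≤ r → IsSymb g r k → SkewWeyl.br D r F k = 0 := by
    intro r k hr hk
    by_contra h0
    have h1 := hF.br hk
    have h2 := hbound _ _ h0 h1
    have h3 : P ((D : ℤ) + r - 2).toNat :=
      ⟨_, h0, by rwa [Int.toNat_of_nonneg (by omega)]⟩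
    have h4 := Nat.le_findGreatest (n := N) (by omega) h3
    omega
  exact br_eq_zero_of_common (by omega) hF0 (htop s f hs hf) (htop t h ht hh)

/-- In a finite-dimensional Lie subalgebra, the symbol of a monomial of degree at least three
Poisson commutes with the symbols of all monomials. -/
theorem br_binom_eq_zero {g : LieSubalgebra ℝ skewWeyl} [FiniteDimensional ℝ g]
    {u v u' v' : ℂ} {b a b' a' : ℕ} (hab : b ≤ a) (hab' : b' ≤ a')
    (hu : u ≠ 0) (hv : v ≠ 0) (hu' : u' ≠ 0) (hv' : v' ≠ 0) (huv : b = a → u + v ≠ 0)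
    (huv' : b' = a' → u' + v' ≠ 0) (hs : 3 ≤ a + b)
    (hf : IsSymb g ((a : ℤ) + b) (binom u v b a))
    (hh : IsSymb g ((a' : ℤ) + b') (binom u' v' b' a')) :
    br ((a : ℤ) + b) ((a' : ℤ) + b') (binom u v b a) (binom u' v' b' a') = 0 := by
  have hs' : 3 ≤ (a : ℤ) + b := by exact_mod_cast hs
  have h1 := hf.br hh
  obtain ht | ht | ht | ht : a' + b' = 0 ∨ a' + b' = 1 ∨ a' + b' = 2 ∨ 3 ≤ a' + b' := by omega
  · obtain ⟨rfl, rfl⟩ : a' = 0 ∧ b' = 0 := by omega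
    simp [br, binom]
  · obtain ⟨rfl, rfl⟩ : a' = 1 ∧ b' = 0 := by omega
    have e : ((1 : ℕ) : ℤ) + (0 : ℕ) = 1 := by norm_num
    rw [e] at h1
    -- One bracket has degree `s - 1`, which may be only two; after the second the degree `2s - 3`
    -- is at least three, so the bracket of the two high-degree symbols must vanish.
    have h2 := hf.br h1
    rw [show (a : ℤ) + b + 1 - 2 = (a : ℤ) + b - 1 by ring] at h2
    rw [show (a : ℤ) + b + ((a : ℤ) + b - 1) - 2 = 2 * ((a : ℤ) + b) - 3 by ring] at h2
    exact absurd (hf.br_eq_zero h2 hs' (by omega)) (br_binom_linear hab hu hv hu' hv' huv hs)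
  · have e : (a' : ℤ) + b' = 2 := by exact_mod_cast ht
    rw [e] at h1 ⊢
    rw [add_sub_cancel_right] at h1
    exact br_binom_quadratic hab hab' hu hv hv' huv huv' hs ht (hf.br_eq_zero h1 hs' hs')
  · exact hf.br_eq_zero hh hs' (by exact_mod_cast ht)

/-- By the Jacobi identity the centralizer of any set is a subalgebra. This is applied first to each
generator, then to each element of the closure. -/
theorem isLieAbelian_lieClosure {G : Set skewWeyl} (h : ∀ x ∈ G, ∀ y ∈ G, ⁅x, y⁆ = 0) :
    IsLieAbelian (lieClosure G) := by
  have h1 : ∀ x ∈ G, ∀ y ∈ lieClosure G, ⁅x, y⁆ = 0 := by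
    intro x hx y hy
    induction hy using LieSubalgebra.lieSpan_induction with
    | mem y hy => exact h x hx y hy
    | zero => exact lie_zero x
    | add y z _ _ hy hz => rw [lie_add, hy, hz, add_zero]
    | smul c y _ hy => rw [lie_smul, hy, smul_zero]
    | lie y z _ _ hy hz => rw [leibniz_lie, hy, hz, zero_lie, lie_zero, add_zero]
  refine ⟨fun x y => Subtype.ext ?_⟩
  change ⁅(x : skewWeyl), (y : skewWeyl)⁆ = 0
  obtain ⟨x, hx⟩ := x
  change ⁅x, (y : skewWeyl)⁆ = 0
  induction hx using LieSubalgebra.lieSpan_induction with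
  | mem x hx => exact h1 x hx y y.2
  | zero => exact zero_lie _
  | add x z _ _ hx hz => rw [add_lie, hx, hz, add_zero]
  | smul c x _ hx => rw [smul_lie, hx, smul_zero]
  | lie x z _ _ hx hz => rw [lie_lie, hx, hz, lie_zero, lie_zero, sub_zero]

/-- The generators of a non-abelian finite-dimensional Lie algebra are fundamental. -/
theorem fundamental_of_not_isLieAbelian {G : Set skewWeyl} (hG : ∀ x ∈ G, IsMonomial x)
    [FiniteDimensional ℝ (lieClosure G)] (hab : ¬ IsLieAbelian (lieClosure G)) :
    ∀ x ∈ G, ∃ c : ℝ, c ≠ 0 ∧ ∃ y ∈ fundamental, x = c • y := by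
  intro m hm
  obtain ⟨u, v, b, a, hba, hu, hv, huv, e, hlow⟩ := (hG m hm).exists_weylBinom
  by_cases hs : a + b < 3
  · exact hlow hs
  rw [not_lt] at hs
  refine absurd ?_ hab
  -- A single generator `m` of degree at least three forces all pairs `x`, `y` to commute, because
  -- both symbols commute with that of `m`.
  refine isLieAbelian_lieClosure fun x hx y hy => ?_
  have hsymb : ∀ {x : skewWeyl} {u v : ℂ} {b a : ℕ}, x ∈ G → (x : Weyl) = weylBinom u v b a →
      IsSymb (lieClosure G) ((a : ℤ) + b) (binom u v b a) := fun {x u v b a} hx e =>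
    ⟨x, LieSubalgebra.subset_lieSpan hx, e ▸ weylBinom_mem_filt u v b a,
      e ▸ symb_weylBinom u v b a⟩
  obtain ⟨u₁, v₁, b₁, a₁, hba₁, hu₁, hv₁, huv₁, e₁, -⟩ := (hG x hx).exists_weylBinom
  obtain ⟨u₂, v₂, b₂, a₂, hba₂, hu₂, hv₂, huv₂, e₂, -⟩ := (hG y hy).exists_weylBinom
  have h1 := br_binom_eq_zero hba hba₁ hu hv hu₁ hv₁ huv huv₁ hs (hsymb hm e) (hsymb hx e₁)
  have h2 := br_binom_eq_zero hba hba₂ hu hv hu₂ hv₂ huv huv₂ hs (hsymb hm e) (hsymb hy e₂)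
  have hm0 : binom u v b a ≠ 0 := fun h => coeff_binom_ne_zero hv huv (by rw [h, coeff_zero])
  have h3 := br_eq_zero_of_common (by omega) hm0 h1 h2
  apply Subtype.ext
  change ⁅(x : Weyl), (y : Weyl)⁆ = 0
  rw [e₁, e₂]
  exact lie_weylBinom_eq_zero hba₁ hba₂ hv₁ hu₂ hv₂ huv₁ huv₂ h3

/-! ### Brackets of the fundamental monomials -/

/-- The commutation relation in right-associated form: together with `ann_mul_cre` and `mul_assoc`
it rewrites every word into normal order, which settles the brackets below. -/
theorem ann_mul_cre_mul (x : Weyl) : ann * (cre * x) = cre * (ann * x) + x := by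
  rw [← mul_assoc, ann_mul_cre, add_mul, mul_assoc, one_mul]

theorem coe_imag : (imag : Weyl) = Complex.I • 1 := rfl

theorem coe_number : (number : Weyl) = Complex.I • (cre * ann) := rfl

theorem coe_gPlus_one : (gPlus 1 0 : Weyl) = Complex.I • (ann + cre) := by
  simp [gPlus, normal]

theorem coe_gMinus_one : (gMinus 1 0 : Weyl) = ann - cre := by
  simp [gMinus, normal]

theorem coe_gPlus_two : (gPlus 2 0 : Weyl) = Complex.I • (ann * ann + cre * cre) := by
  simp [gPlus, normal, sq]

theorem coe_gMinus_two : (gMinus 2 0 : Weyl) = ann * ann - cre * cre := by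
  simp [gMinus, normal, sq]

theorem imag_lie (x : skewWeyl) : ⁅imag, x⁆ = 0 := by
  apply Subtype.ext
  rw [LieSubalgebra.coe_bracket, coe_imag, complex_smul_lie, Ring.lie_def, one_mul, mul_one,
    sub_self, smul_zero]
  rfl

theorem lie_imag (x : skewWeyl) : ⁅x, imag⁆ = 0 := by
  rw [← lie_skew, imag_lie, neg_zero]

theorem gPlus_one_lie_gMinus_one : ⁅gPlus 1 0, gMinus 1 0⁆ = (-2 : ℝ) • imag := by
  apply Subtype.ext
  change ⁅(gPlus 1 0 : Weyl), (gMinus 1 0 : Weyl)⁆ = (-2 : ℝ) • (imag : Weyl)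
  rw [coe_gPlus_one, coe_gMinus_one, coe_imag, ← Complex.coe_smul, complex_smul_lie, smul_comm]
  congr 1
  simp only [Ring.lie_def, mul_add, add_mul, mul_sub, sub_mul, ann_mul_cre]
  push_cast
  module

theorem number_lie_gPlus_one : ⁅number, gPlus 1 0⁆ = gMinus 1 0 := by
  apply Subtype.ext
  change ⁅(number : Weyl), (gPlus 1 0 : Weyl)⁆ = (gMinus 1 0 : Weyl)
  rw [coe_gPlus_one, coe_gMinus_one, coe_number, complex_smul_lie, lie_complex_smul, smul_smul,
    Complex.I_mul_I]
  simp only [Ring.lie_def, mul_add, add_mul, mul_assoc, ann_mul_cre, ann_mul_cre_mul, mul_one]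
  module

theorem number_lie_gMinus_one : ⁅number, gMinus 1 0⁆ = -gPlus 1 0 := by
  apply Subtype.ext
  change ⁅(number : Weyl), (gMinus 1 0 : Weyl)⁆ = -(gPlus 1 0 : Weyl)
  rw [coe_gPlus_one, coe_gMinus_one, coe_number, complex_smul_lie, ← smul_neg]
  congr 1
  simp only [Ring.lie_def, mul_sub, sub_mul, mul_assoc, ann_mul_cre, ann_mul_cre_mul, mul_add,
    mul_one]
  module

theorem gPlus_two_lie_gPlus_one : ⁅gPlus 2 0, gPlus 1 0⁆ = (-2 : ℝ) • gMinus 1 0 := by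
  apply Subtype.ext
  change ⁅(gPlus 2 0 : Weyl), (gPlus 1 0 : Weyl)⁆ = (-2 : ℝ) • (gMinus 1 0 : Weyl)
  rw [coe_gPlus_one, coe_gMinus_one, coe_gPlus_two, complex_smul_lie, lie_complex_smul, smul_smul,
    Complex.I_mul_I]
  simp only [Ring.lie_def, mul_add, add_mul, mul_assoc, ann_mul_cre, ann_mul_cre_mul, mul_one]
  module

theorem gPlus_two_lie_gMinus_one : ⁅gPlus 2 0, gMinus 1 0⁆ = (-2 : ℝ) • gPlus 1 0 := by
  apply Subtype.ext
  change ⁅(gPlus 2 0 : Weyl), (gMinus 1 0 : Weyl)⁆ = (-2 : ℝ) • (gPlus 1 0 : Weyl)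
  rw [coe_gPlus_one, coe_gMinus_one, coe_gPlus_two, ← Complex.coe_smul, complex_smul_lie, smul_comm]
  congr 1
  simp only [Ring.lie_def, mul_add, add_mul, mul_sub, sub_mul, mul_assoc, ann_mul_cre,
    ann_mul_cre_mul, mul_one]
  push_cast
  module

theorem gMinus_two_lie_gPlus_one : ⁅gMinus 2 0, gPlus 1 0⁆ = (2 : ℝ) • gPlus 1 0 := by
  apply Subtype.ext
  change ⁅(gMinus 2 0 : Weyl), (gPlus 1 0 : Weyl)⁆ = (2 : ℝ) • (gPlus 1 0 : Weyl)
  rw [coe_gPlus_one, coe_gMinus_two, ← Complex.coe_smul, lie_complex_smul, smul_comm]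
  congr 1
  simp only [Ring.lie_def, mul_add, add_mul, mul_sub, sub_mul, mul_assoc, ann_mul_cre,
    ann_mul_cre_mul, mul_one]
  push_cast
  module

theorem gMinus_two_lie_gMinus_one : ⁅gMinus 2 0, gMinus 1 0⁆ = (-2 : ℝ) • gMinus 1 0 := by
  apply Subtype.ext
  change ⁅(gMinus 2 0 : Weyl), (gMinus 1 0 : Weyl)⁆ = (-2 : ℝ) • (gMinus 1 0 : Weyl)
  rw [coe_gMinus_one, coe_gMinus_two]
  simp only [Ring.lie_def, mul_add, mul_sub, sub_mul, mul_assoc, ann_mul_cre, ann_mul_cre_mul, mul_one]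
  module

theorem number_lie_gPlus_two : ⁅number, gPlus 2 0⁆ = (2 : ℝ) • gMinus 2 0 := by
  apply Subtype.ext
  change ⁅(number : Weyl), (gPlus 2 0 : Weyl)⁆ = (2 : ℝ) • (gMinus 2 0 : Weyl)
  rw [coe_gPlus_two, coe_gMinus_two, coe_number, complex_smul_lie, lie_complex_smul, smul_smul,
    Complex.I_mul_I]
  simp only [Ring.lie_def, mul_add, add_mul, mul_assoc, ann_mul_cre, ann_mul_cre_mul, mul_one]
  module

theorem number_lie_gMinus_two : ⁅number, gMinus 2 0⁆ = (-2 : ℝ) • gPlus 2 0 := by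
  apply Subtype.ext
  change ⁅(number : Weyl), (gMinus 2 0 : Weyl)⁆ = (-2 : ℝ) • (gPlus 2 0 : Weyl)
  rw [coe_gPlus_two, coe_gMinus_two, coe_number, ← Complex.coe_smul, complex_smul_lie, smul_comm]
  congr 1
  simp only [Ring.lie_def, mul_add, mul_sub, sub_mul, mul_assoc, ann_mul_cre,
    ann_mul_cre_mul, mul_one]
  push_cast
  module

theorem gPlus_two_lie_gMinus_two :
    ⁅gPlus 2 0, gMinus 2 0⁆ = (-8 : ℝ) • number + (-4 : ℝ) • imag := by
  apply Subtype.ext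
  change ⁅(gPlus 2 0 : Weyl), (gMinus 2 0 : Weyl)⁆ =
    (-8 : ℝ) • (number : Weyl) + (-4 : ℝ) • (imag : Weyl)
  rw [coe_gPlus_two, coe_gMinus_two, coe_number, coe_imag, ← Complex.coe_smul, ← Complex.coe_smul,
    complex_smul_lie, smul_comm _ Complex.I, smul_comm _ Complex.I, ← smul_add]
  congr 1
  simp only [Ring.lie_def, mul_add, add_mul, mul_sub, sub_mul, mul_assoc, ann_mul_cre,
    ann_mul_cre_mul, mul_one]
  push_cast
  module

theorem gMinus_one_lie_gPlus_one : ⁅gMinus 1 0, gPlus 1 0⁆ = (2 : ℝ) • imag := by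
  rw [← lie_skew, gPlus_one_lie_gMinus_one]; module

theorem gPlus_one_lie_number : ⁅gPlus 1 0, number⁆ = -gMinus 1 0 := by
  rw [← lie_skew, number_lie_gPlus_one]

theorem gMinus_one_lie_number : ⁅gMinus 1 0, number⁆ = gPlus 1 0 := by
  rw [← lie_skew, number_lie_gMinus_one, neg_neg]

theorem gPlus_one_lie_gPlus_two : ⁅gPlus 1 0, gPlus 2 0⁆ = (2 : ℝ) • gMinus 1 0 := by
  rw [← lie_skew, gPlus_two_lie_gPlus_one]; module

theorem gMinus_one_lie_gPlus_two : ⁅gMinus 1 0, gPlus 2 0⁆ = (2 : ℝ) • gPlus 1 0 := by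
  rw [← lie_skew, gPlus_two_lie_gMinus_one]; module

theorem gPlus_one_lie_gMinus_two : ⁅gPlus 1 0, gMinus 2 0⁆ = (-2 : ℝ) • gPlus 1 0 := by
  rw [← lie_skew, gMinus_two_lie_gPlus_one]; module

theorem gMinus_one_lie_gMinus_two : ⁅gMinus 1 0, gMinus 2 0⁆ = (2 : ℝ) • gMinus 1 0 := by
  rw [← lie_skew, gMinus_two_lie_gMinus_one]; module

theorem gPlus_two_lie_number : ⁅gPlus 2 0, number⁆ = (-2 : ℝ) • gMinus 2 0 := by
  rw [← lie_skew, number_lie_gPlus_two]; module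

theorem gMinus_two_lie_number : ⁅gMinus 2 0, number⁆ = (2 : ℝ) • gPlus 2 0 := by
  rw [← lie_skew, number_lie_gMinus_two]; module

theorem gMinus_two_lie_gPlus_two :
    ⁅gMinus 2 0, gPlus 2 0⁆ = (8 : ℝ) • number + (4 : ℝ) • imag := by
  rw [← lie_skew, gPlus_two_lie_gMinus_two]; module

/-! ### Coordinates -/

/-- Coordinates of an element of `Â₁` along the six fundamental monomials. -/
def coord : skewWeyl →ₗ[ℝ] (Fin 6 → ℝ) where
  -- The coefficients at `(1, 0)` and `(2, 0)` are determined by those at `(0, 1)` and `(0, 2)`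
  -- through skew-hermiticity.
  toFun x := ![(normalCoeff x (0, 0)).im, (normalCoeff x (1, 1)).im, (normalCoeff x (0, 1)).im,
    (normalCoeff x (0, 1)).re, (normalCoeff x (0, 2)).im, (normalCoeff x (0, 2)).re]
  map_add' x y := by
    rw [show ((x + y : skewWeyl) : Weyl) = (x : Weyl) + y from rfl, map_add]
    ext i; fin_cases i <;> simp
  map_smul' c x := by
    rw [show ((c • x : skewWeyl) : Weyl) = (c : ℂ) • (x : Weyl) from
      (Complex.coe_smul c (x : Weyl)).symm, map_smul]
    ext i; fin_cases i <;> simp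

theorem coord_apply (x : skewWeyl) :
    coord x = ![(normalCoeff x (0, 0)).im, (normalCoeff x (1, 1)).im, (normalCoeff x (0, 1)).im,
    (normalCoeff x (0, 1)).re, (normalCoeff x (0, 2)).im, (normalCoeff x (0, 2)).re] := rfl

theorem coord_imag : coord imag = ![1, 0, 0, 0, 0, 0] := by
  rw [coord_apply, coe_imag, ← normal_zero_zero, map_smul, normalCoeff_normal]
  simp

theorem coord_number : coord number = ![0, 1, 0, 0, 0, 0] := by
  rw [coord_apply, coe_number, show cre * ann = normal 1 1 by simp [normal], map_smul,
    normalCoeff_normal]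
  simp

theorem coord_gPlus_one : coord (gPlus 1 0) = ![0, 0, 1, 0, 0, 0] := by
  rw [coord_apply, show (gPlus 1 0 : Weyl) = Complex.I • (normal 0 1 + normal 1 0) from rfl,
    map_smul, map_add, normalCoeff_normal, normalCoeff_normal]
  simp

theorem coord_gMinus_one : coord (gMinus 1 0) = ![0, 0, 0, 1, 0, 0] := by
  rw [coord_apply, show (gMinus 1 0 : Weyl) = normal 0 1 - normal 1 0 from rfl,
    map_sub, normalCoeff_normal, normalCoeff_normal]
  simp

theorem coord_gPlus_two : coord (gPlus 2 0) = ![0, 0, 0, 0, 1, 0] := by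
  rw [coord_apply, show (gPlus 2 0 : Weyl) = Complex.I • (normal 0 2 + normal 2 0) from rfl,
    map_smul, map_add, normalCoeff_normal, normalCoeff_normal]
  simp

theorem coord_gMinus_two : coord (gMinus 2 0) = ![0, 0, 0, 0, 0, 1] := by
  rw [coord_apply, show (gMinus 2 0 : Weyl) = normal 0 2 - normal 2 0 from rfl,
    map_sub, normalCoeff_normal, normalCoeff_normal]
  simp

/-! ### Realizations of the abstract algebras -/

/-- The linear map on coordinate vectors with prescribed values on the standard basis. -/
def combo {n : ℕ} (v : Fin n → skewWeyl) : (Fin n → ℝ) →ₗ[ℝ] skewWeyl :=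
  Fintype.linearCombination ℝ v

theorem combo_apply {n : ℕ} (v : Fin n → skewWeyl) (u : Fin n → ℝ) :
    combo v u = ∑ i, u i • v i := rfl

/-- `B` is a basis of a Lie subalgebra, which is isomorphic to `L'`. -/
structure Realizes (B : Set skewWeyl) (L' : Type) [LieRing L'] [LieAlgebra ℝ L'] : Prop where
  toSubmodule_eq : (lieClosure B).toSubmodule = Submodule.span ℝ B
  iso : Nonempty (lieClosure B ≃ₗ⁅ℝ⁆ L')

/-- The range of `φ` is a subalgebra containing `B` and contained in the span of `B`, which lies in
the Lie closure of `B`. So all three coincide, and injectivity of `φ` supplies the isomorphism. -/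
theorem Realizes.of_hom {L' : Type} [LieRing L'] [LieAlgebra ℝ L'] {B : Set skewWeyl}
    (φ : L' →ₗ⁅ℝ⁆ skewWeyl) (hφ : ∀ x, φ x = 0 → x = 0) (hB : ∀ b ∈ B, ∃ x, φ x = b)
    (hr : ∀ x, φ x ∈ Submodule.span ℝ B) : Realizes B L' := by
  have hinj : Function.Injective φ :=
    (injective_iff_map_eq_zero (φ : L' →ₗ[ℝ] skewWeyl)).2 hφ
  have h1 : lieClosure B ≤ φ.range := LieSubalgebra.lieSpan_le.2 fun b hb => by
    obtain ⟨x, rfl⟩ := hB b hb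
    exact ⟨x, rfl⟩
  have h2 : Submodule.span ℝ B ≤ (lieClosure B).toSubmodule :=
    LieSubalgebra.submodule_span_le_lieSpan
  have h3 : φ.range.toSubmodule ≤ Submodule.span ℝ B := by
    rintro _ ⟨x, rfl⟩
    exact hr x
  have h4 : lieClosure B = φ.range := le_antisymm h1 fun x hx => h2 (h3 hx)
  refine ⟨le_antisymm (fun x hx => h3 (h1 hx)) h2, ?_⟩
  rw [h4]
  exact ⟨(LieEquiv.ofInjective φ hinj).symm⟩

/-- The real number underlying an element of the one-dimensional algebra. -/
def Line.toReal (x : Line) : ℝ := x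

/-- The extension of a homomorphism by a central line on the left. -/
def centralLeft {L' : Type} [LieRing L'] [LieAlgebra ℝ L'] (φ : L' →ₗ⁅ℝ⁆ skewWeyl) :
    Line × L' →ₗ⁅ℝ⁆ skewWeyl where
  toFun x := x.1.toReal • imag + φ x.2
  map_add' x y := by
    change (x.1.toReal + y.1.toReal) • imag + φ (x.2 + y.2) = _
    rw [map_add, add_smul]
    abel
  map_smul' c x := by
    change (c * x.1.toReal) • imag + φ (c • x.2) = c • (x.1.toReal • imag + φ x.2)
    rw [map_smul, mul_smul, ← smul_add]
  map_lie' {x y} := by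
    change (0 : ℝ) • imag + φ ⁅x.2, y.2⁆ = ⁅x.1.toReal • imag + φ x.2, y.1.toReal • imag + φ y.2⁆
    simp only [LieHom.map_lie, add_lie, lie_add, smul_lie, lie_smul, imag_lie, lie_imag, smul_zero,
      zero_smul, zero_add]

theorem centralLeft_apply {L' : Type} [LieRing L'] [LieAlgebra ℝ L'] (φ : L' →ₗ⁅ℝ⁆ skewWeyl)
    (x : Line × L') : centralLeft φ x = x.1.toReal • imag + φ x.2 := rfl

/-- The extension of a homomorphism by a central line on the right. -/
def centralRight {L' : Type} [LieRing L'] [LieAlgebra ℝ L'] (φ : L' →ₗ⁅ℝ⁆ skewWeyl) :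
    L' × Line →ₗ⁅ℝ⁆ skewWeyl where
  toFun x := φ x.1 + x.2.toReal • imag
  map_add' x y := by
    change φ (x.1 + y.1) + (x.2.toReal + y.2.toReal) • imag = _
    rw [map_add, add_smul]
    abel
  map_smul' c x := by
    change φ (c • x.1) + (c * x.2.toReal) • imag = c • (φ x.1 + x.2.toReal • imag)
    rw [map_smul, mul_smul, ← smul_add]
  map_lie' {x y} := by
    change φ ⁅x.1, y.1⁆ + (0 : ℝ) • imag = ⁅φ x.1 + x.2.toReal • imag, φ y.1 + y.2.toReal • imag⁆
    simp only [LieHom.map_lie, add_lie, lie_add, smul_lie, lie_smul, imag_lie, lie_imag, smul_zero,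
      zero_smul, add_zero]

theorem centralRight_apply {L' : Type} [LieRing L'] [LieAlgebra ℝ L'] (φ : L' →ₗ⁅ℝ⁆ skewWeyl)
    (x : L' × Line) : centralRight φ x = φ x.1 + x.2.toReal • imag := rfl

/-- The realization of `aff(1)` on `P, B`. -/
def affPlus : Aff →ₗ⁅ℝ⁆ skewWeyl where
  toLinearMap := combo ![(1 / 2 : ℝ) • gMinus 2 0, gPlus 1 0]
  map_lie' {x y} := by
    revert x y
    intro (u : Fin 2 → ℝ) (v : Fin 2 → ℝ)
    change combo _ (affBr u v) = ⁅combo _ u, combo _ v⁆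
    simp [combo_apply, affBr, Fin.sum_univ_succ, gMinus_two_lie_gPlus_one,
      gPlus_one_lie_gMinus_two]
    module

theorem affPlus_apply (u : Fin 2 → ℝ) :
    affPlus u = u 0 • (1 / 2 : ℝ) • gMinus 2 0 + u 1 • gPlus 1 0 := by
  change combo _ u = _
  simp [combo_apply, Fin.sum_univ_succ]

/-- The realization of `aff(1)` on `Q, B`. -/
def affMinus : Aff →ₗ⁅ℝ⁆ skewWeyl where
  toLinearMap := combo ![(-1 / 2 : ℝ) • gMinus 2 0, gMinus 1 0]
  map_lie' {x y} := by
    revert x y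
    intro (u : Fin 2 → ℝ) (v : Fin 2 → ℝ)
    change combo _ (affBr u v) = ⁅combo _ u, combo _ v⁆
    simp [combo_apply, affBr, Fin.sum_univ_succ, gMinus_two_lie_gMinus_one,
      gMinus_one_lie_gMinus_two]
    module

theorem affMinus_apply (u : Fin 2 → ℝ) :
    affMinus u = u 0 • (-1 / 2 : ℝ) • gMinus 2 0 + u 1 • gMinus 1 0 := by
  change combo _ u = _
  simp [combo_apply, Fin.sum_univ_succ]

/-- The realization of `h₁` on `i, P, Q`. -/
def heisHom : Heis →ₗ⁅ℝ⁆ skewWeyl where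
  toLinearMap := combo ![gPlus 1 0, gMinus 1 0, (-2 : ℝ) • imag]
  map_lie' {x y} := by
    revert x y
    intro (u : Fin 3 → ℝ) (v : Fin 3 → ℝ)
    change combo _ (heisBr u v) = ⁅combo _ u, combo _ v⁆
    simp [combo_apply, heisBr, Fin.sum_univ_succ,
      imag_lie, lie_imag, gPlus_one_lie_gMinus_one, gMinus_one_lie_gPlus_one]
    module

theorem heisHom_apply (u : Fin 3 → ℝ) :
    heisHom u = u 0 • (gPlus 1 0) + u 1 • (gMinus 1 0) + u 2 • ((-2 : ℝ) • imag) := by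
  change combo _ u = _
  simp [combo_apply, Fin.sum_univ_succ, add_assoc]

/-- The realization of `wh₁` on `i, P, Q, A`. -/
def wh1Plus : WH1 →ₗ⁅ℝ⁆ skewWeyl where
  -- `P + Q` and `P - Q` are the eigenvectors of `ad A`, with eigenvalues `-2` and `2`; their
  -- bracket is `-2 [P, Q] = 4 i`.
  toLinearMap := combo ![(4 : ℝ) • imag, gPlus 1 0 + gMinus 1 0, gPlus 1 0 - gMinus 1 0, (1 / 2 : ℝ) • gPlus 2 0]
  map_lie' {x y} := by
    revert x y
    intro (u : Fin 4 → ℝ) (v : Fin 4 → ℝ)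
    change combo _ (wh1Br u v) = ⁅combo _ u, combo _ v⁆
    simp [combo_apply, wh1Br, Fin.sum_univ_succ,
      imag_lie, lie_imag, gPlus_one_lie_gMinus_one, gPlus_one_lie_gPlus_two,
      gMinus_one_lie_gPlus_one, gMinus_one_lie_gPlus_two, gPlus_two_lie_gPlus_one,
      gPlus_two_lie_gMinus_one]
    module

theorem wh1Plus_apply (u : Fin 4 → ℝ) :
    wh1Plus u = u 0 • ((4 : ℝ) • imag) + u 1 • (gPlus 1 0 + gMinus 1 0) + u 2 • (gPlus 1 0 - gMinus 1 0) + u 3 • ((1 / 2 : ℝ) • gPlus 2 0) := by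
  change combo _ u = _
  simp [combo_apply, Fin.sum_univ_succ, add_assoc]

/-- The realization of `wh₁` on `i, P, Q, B`. -/
def wh1Minus : WH1 →ₗ⁅ℝ⁆ skewWeyl where
  toLinearMap := combo ![(-2 : ℝ) • imag, gPlus 1 0, gMinus 1 0, (-1 / 2 : ℝ) • gMinus 2 0]
  map_lie' {x y} := by
    revert x y
    intro (u : Fin 4 → ℝ) (v : Fin 4 → ℝ)
    change combo _ (wh1Br u v) = ⁅combo _ u, combo _ v⁆
    simp [combo_apply, wh1Br, Fin.sum_univ_succ,
      imag_lie, lie_imag, gPlus_one_lie_gMinus_one, gPlus_one_lie_gMinus_two,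
      gMinus_one_lie_gPlus_one, gMinus_one_lie_gMinus_two, gMinus_two_lie_gPlus_one,
      gMinus_two_lie_gMinus_one]
    module

theorem wh1Minus_apply (u : Fin 4 → ℝ) :
    wh1Minus u = u 0 • ((-2 : ℝ) • imag) + u 1 • (gPlus 1 0) + u 2 • (gMinus 1 0) + u 3 • ((-1 / 2 : ℝ) • gMinus 2 0) := by
  change combo _ u = _
  simp [combo_apply, Fin.sum_univ_succ, add_assoc]

/-- The realization of `wh₂` on `i, N, P, Q`. -/
def wh2Hom : WH2 →ₗ⁅ℝ⁆ skewWeyl where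
  toLinearMap := combo ![number, gPlus 1 0, -gMinus 1 0, (2 : ℝ) • imag]
  map_lie' {x y} := by
    revert x y
    intro (u : Fin 4 → ℝ) (v : Fin 4 → ℝ)
    change combo _ (wh2Br u v) = ⁅combo _ u, combo _ v⁆
    simp [combo_apply, wh2Br, Fin.sum_univ_succ,
      imag_lie, lie_imag, number_lie_gPlus_one, number_lie_gMinus_one, gPlus_one_lie_number,
      gPlus_one_lie_gMinus_one, gMinus_one_lie_number, gMinus_one_lie_gPlus_one]
    module

theorem wh2Hom_apply (u : Fin 4 → ℝ) :
    wh2Hom u = u 0 • number + u 1 • (gPlus 1 0) + u 2 • (-gMinus 1 0) + u 3 • ((2 : ℝ) • imag) := by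
  change combo _ u = _
  simp [combo_apply, Fin.sum_univ_succ, add_assoc]

/-- The realization of the Schrödinger algebra. -/
def schrHom : Schr →ₗ⁅ℝ⁆ skewWeyl where
  -- The images of `x` and `y` are `(i/4)(a + a†)²` and `(i/4)(a - a†)²`. As `B / 2` has weight `1`
  -- on `P` and `-1` on `Q`, it has weights `2` and `-2` on these.
  toLinearMap := combo ![(1 / 2 : ℝ) • gMinus 2 0, (1 / 4 : ℝ) • gPlus 2 0 + (1 / 2 : ℝ) • number + (1 / 4 : ℝ) • imag, (1 / 4 : ℝ) • gPlus 2 0 + (-1 / 2 : ℝ) • number + (-1 / 4 : ℝ) • imag, gPlus 1 0, -gMinus 1 0, (2 : ℝ) • imag]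
  map_lie' {x y} := by
    revert x y
    intro (u : Fin 6 → ℝ) (v : Fin 6 → ℝ)
    change combo _ (schrBr u v) = ⁅combo _ u, combo _ v⁆
    simp [combo_apply, schrBr, Fin.sum_univ_succ,
      imag_lie, lie_imag, number_lie_gPlus_one, number_lie_gMinus_one, number_lie_gPlus_two,
      number_lie_gMinus_two, gPlus_one_lie_number, gPlus_one_lie_gMinus_one,
      gPlus_one_lie_gPlus_two, gPlus_one_lie_gMinus_two, gMinus_one_lie_number,
      gMinus_one_lie_gPlus_one, gMinus_one_lie_gPlus_two, gMinus_one_lie_gMinus_two,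
      gPlus_two_lie_number, gPlus_two_lie_gPlus_one, gPlus_two_lie_gMinus_one,
      gPlus_two_lie_gMinus_two, gMinus_two_lie_number, gMinus_two_lie_gPlus_one,
      gMinus_two_lie_gMinus_one, gMinus_two_lie_gPlus_two]
    module

theorem schrHom_apply (u : Fin 6 → ℝ) :
    schrHom u = u 0 • ((1 / 2 : ℝ) • gMinus 2 0) + u 1 • ((1 / 4 : ℝ) • gPlus 2 0 + (1 / 2 : ℝ) • number + (1 / 4 : ℝ) • imag) + u 2 • ((1 / 4 : ℝ) • gPlus 2 0 + (-1 / 2 : ℝ) • number + (-1 / 4 : ℝ) • imag) + u 3 • (gPlus 1 0) + u 4 • (-gMinus 1 0) + u 5 • ((2 : ℝ) • imag) := by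
  change combo _ u = _
  simp [combo_apply, Fin.sum_univ_succ, add_assoc]

theorem sl_two_apply_one_one (M : LieAlgebra.SpecialLinear.sl (Fin 2) ℝ) :
    M.1 1 1 = -M.1 0 0 := by
  have h : Matrix.trace M.1 = 0 := M.2
  rw [Matrix.trace_fin_two] at h
  linarith

/-- The realization of `sl(2, ℝ)` on `A, B, N + i / 2`. -/
def slHom : LieAlgebra.SpecialLinear.sl (Fin 2) ℝ →ₗ⁅ℝ⁆ skewWeyl where
  toFun M := M.1 0 0 • (1 / 2 : ℝ) • gMinus 2 0 + M.1 0 1 • ((1 / 4 : ℝ) • gPlus 2 0 + (1 / 2 : ℝ) • number + (1 / 4 : ℝ) • imag) +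
    M.1 1 0 • ((1 / 4 : ℝ) • gPlus 2 0 + (-1 / 2 : ℝ) • number + (-1 / 4 : ℝ) • imag)
  map_add' M M' := by
    change (M.1 + M'.1) 0 0 • _ + (M.1 + M'.1) 0 1 • _ + (M.1 + M'.1) 1 0 • _ = _
    simp only [Matrix.add_apply]
    module
  map_smul' c M := by
    change (c • M.1) 0 0 • _ + (c • M.1) 0 1 • _ + (c • M.1) 1 0 • _ = c • _
    simp only [Matrix.smul_apply, smul_eq_mul]
    module
  map_lie' {M M'} := by
    have e : (⁅M, M'⁆ : LieAlgebra.SpecialLinear.sl (Fin 2) ℝ).1 = M.1 * M'.1 - M'.1 * M.1 := rfl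
    simp only [e, Matrix.sub_apply, Matrix.mul_apply, Fin.sum_univ_two, sl_two_apply_one_one,
      add_lie, lie_add, smul_lie, lie_smul, lie_self,
      imag_lie, lie_imag, number_lie_gPlus_two, number_lie_gMinus_two, gPlus_two_lie_number,
      gPlus_two_lie_gMinus_two, gMinus_two_lie_number, gMinus_two_lie_gPlus_two]
    module

theorem slHom_apply (M : LieAlgebra.SpecialLinear.sl (Fin 2) ℝ) :
    slHom M = M.1 0 0 • (1 / 2 : ℝ) • gMinus 2 0 + M.1 0 1 • ((1 / 4 : ℝ) • gPlus 2 0 + (1 / 2 : ℝ) • number + (1 / 4 : ℝ) • imag) +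
    M.1 1 0 • ((1 / 4 : ℝ) • gPlus 2 0 + (-1 / 2 : ℝ) • number + (-1 / 4 : ℝ) • imag) := rfl

/-! ### Bases and isomorphism types of the listed subalgebras -/

theorem realizes_affPlus : Realizes {gPlus 1 0, gMinus 2 0} Aff := by
  refine Realizes.of_hom affPlus ?_ ?_ ?_
  · intro (u : Fin 2 → ℝ) hu
    have h := congrArg coord hu
    rw [affPlus_apply] at h
    simp [coord_gPlus_one, coord_gMinus_two] at h
    change u = 0
    ext i; fin_cases i <;> simp <;> linarith
  · rintro b (rfl | rfl)
    · exact ⟨(![0, 1] : Fin 2 → ℝ), by rw [affPlus_apply]; simp⟩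
    · exact ⟨(![2, 0] : Fin 2 → ℝ), by rw [affPlus_apply]; simp⟩
  · intro (u : Fin 2 → ℝ)
    rw [affPlus_apply]
    repeat first
      | apply Submodule.add_mem
      | apply Submodule.sub_mem
      | apply Submodule.smul_mem
      | apply Submodule.neg_mem
      | exact Submodule.subset_span (by simp)

theorem realizes_affMinus : Realizes {gMinus 1 0, gMinus 2 0} Aff := by
  refine Realizes.of_hom affMinus ?_ ?_ ?_
  · intro (u : Fin 2 → ℝ) hu
    have h := congrArg coord hu
    rw [affMinus_apply] at h
    simp [coord_gMinus_one, coord_gMinus_two] at h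
    change u = 0
    ext i; fin_cases i <;> simp <;> linarith
  · rintro b (rfl | rfl)
    · exact ⟨(![0, 1] : Fin 2 → ℝ), by rw [affMinus_apply]; simp⟩
    · exact ⟨(![-2, 0] : Fin 2 → ℝ), by rw [affMinus_apply]; simp; module⟩
  · intro (u : Fin 2 → ℝ)
    rw [affMinus_apply]
    repeat first
      | apply Submodule.add_mem
      | apply Submodule.sub_mem
      | apply Submodule.smul_mem
      | apply Submodule.neg_mem
      | exact Submodule.subset_span (by simp)

theorem realizes_lineAffPlus : Realizes {imag, gPlus 1 0, gMinus 2 0} (Line × Aff) := by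
  refine Realizes.of_hom (centralLeft affPlus) ?_ ?_ ?_
  · rintro ⟨(r : ℝ), (u : Fin 2 → ℝ)⟩ hu
    have h := congrArg coord hu
    rw [centralLeft_apply, affPlus_apply] at h
    simp [coord_imag, coord_gPlus_one, coord_gMinus_two, Line.toReal] at h
    refine Prod.ext h.1 ?_
    change u = 0
    ext i; fin_cases i <;> simp [h]
  · rintro b (rfl | rfl | rfl)
    · exact ⟨((1 : ℝ), (![0, 0] : Fin 2 → ℝ)), by
        rw [centralLeft_apply, affPlus_apply]; simp [Line.toReal]⟩
    · exact ⟨((0 : ℝ), (![0, 1] : Fin 2 → ℝ)), by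
        rw [centralLeft_apply, affPlus_apply]; simp [Line.toReal]⟩
    · exact ⟨((0 : ℝ), (![2, 0] : Fin 2 → ℝ)), by
        rw [centralLeft_apply, affPlus_apply]; simp [Line.toReal]⟩
  · rintro ⟨r, (u : Fin 2 → ℝ)⟩
    rw [centralLeft_apply, affPlus_apply]
    repeat first
      | apply Submodule.add_mem
      | apply Submodule.sub_mem
      | apply Submodule.smul_mem
      | apply Submodule.neg_mem
      | exact Submodule.subset_span (by simp)

theorem realizes_lineAffMinus : Realizes {imag, gMinus 1 0, gMinus 2 0} (Line × Aff) := by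
  refine Realizes.of_hom (centralLeft affMinus) ?_ ?_ ?_
  · rintro ⟨(r : ℝ), (u : Fin 2 → ℝ)⟩ hu
    have h := congrArg coord hu
    rw [centralLeft_apply, affMinus_apply] at h
    simp [coord_imag, coord_gMinus_one, coord_gMinus_two, Line.toReal] at h
    refine Prod.ext h.1 ?_
    change u = 0
    ext i; fin_cases i <;> simp [h]
  · rintro b (rfl | rfl | rfl)
    · exact ⟨((1 : ℝ), (![0, 0] : Fin 2 → ℝ)), by
        rw [centralLeft_apply, affMinus_apply]; simp [Line.toReal]⟩
    · exact ⟨((0 : ℝ), (![0, 1] : Fin 2 → ℝ)), by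
        rw [centralLeft_apply, affMinus_apply]; simp [Line.toReal]⟩
    · exact ⟨((0 : ℝ), (![-2, 0] : Fin 2 → ℝ)), by
        rw [centralLeft_apply, affMinus_apply]; simp [Line.toReal]; module⟩
  · rintro ⟨r, (u : Fin 2 → ℝ)⟩
    rw [centralLeft_apply, affMinus_apply]
    repeat first
      | apply Submodule.add_mem
      | apply Submodule.sub_mem
      | apply Submodule.smul_mem
      | apply Submodule.neg_mem
      | exact Submodule.subset_span (by simp)

theorem realizes_heis : Realizes {imag, gPlus 1 0, gMinus 1 0} Heis := by
  refine Realizes.of_hom heisHom ?_ ?_ ?_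
  · intro (u : Fin 3 → ℝ) hu
    have h := congrArg coord hu
    rw [heisHom_apply] at h
    simp [coord_imag, coord_gPlus_one, coord_gMinus_one] at h
    change u = 0
    ext i; fin_cases i <;> simp <;> linarith
  · rintro b (rfl | rfl | rfl)
    · exact ⟨(![0, 0, -1 / 2] : Fin 3 → ℝ), by rw [heisHom_apply]; simp; module⟩
    · exact ⟨(![1, 0, 0] : Fin 3 → ℝ), by rw [heisHom_apply]; simp⟩
    · exact ⟨(![0, 1, 0] : Fin 3 → ℝ), by rw [heisHom_apply]; simp⟩
  · intro (u : Fin 3 → ℝ)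
    rw [heisHom_apply]
    repeat first
      | apply Submodule.add_mem
      | apply Submodule.sub_mem
      | apply Submodule.smul_mem
      | apply Submodule.neg_mem
      | exact Submodule.subset_span (by simp)

theorem realizes_wh1Plus : Realizes {imag, gPlus 1 0, gMinus 1 0, gPlus 2 0} WH1 := by
  refine Realizes.of_hom wh1Plus ?_ ?_ ?_
  · intro (u : Fin 4 → ℝ) hu
    have h := congrArg coord hu
    rw [wh1Plus_apply] at h
    simp [coord_imag, coord_gPlus_one, coord_gMinus_one, coord_gPlus_two] at h
    change u = 0
    ext i; fin_cases i <;> simp <;> linarith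
  · rintro b (rfl | rfl | rfl | rfl)
    · exact ⟨(![1 / 4, 0, 0, 0] : Fin 4 → ℝ), by rw [wh1Plus_apply]; simp⟩
    · exact ⟨(![0, 1 / 2, 1 / 2, 0] : Fin 4 → ℝ), by rw [wh1Plus_apply]; simp; module⟩
    · exact ⟨(![0, 1 / 2, -1 / 2, 0] : Fin 4 → ℝ), by rw [wh1Plus_apply]; simp; module⟩
    · exact ⟨(![0, 0, 0, 2] : Fin 4 → ℝ), by rw [wh1Plus_apply]; simp⟩
  · intro (u : Fin 4 → ℝ)
    rw [wh1Plus_apply]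
    repeat first
      | apply Submodule.add_mem
      | apply Submodule.sub_mem
      | apply Submodule.smul_mem
      | apply Submodule.neg_mem
      | exact Submodule.subset_span (by simp)

theorem realizes_wh1Minus : Realizes {imag, gPlus 1 0, gMinus 1 0, gMinus 2 0} WH1 := by
  refine Realizes.of_hom wh1Minus ?_ ?_ ?_
  · intro (u : Fin 4 → ℝ) hu
    have h := congrArg coord hu
    rw [wh1Minus_apply] at h
    simp [coord_imag, coord_gPlus_one, coord_gMinus_one, coord_gMinus_two] at h
    change u = 0
    ext i; fin_cases i <;> simp <;> linarith
  · rintro b (rfl | rfl | rfl | rfl)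
    · exact ⟨(![-1 / 2, 0, 0, 0] : Fin 4 → ℝ), by rw [wh1Minus_apply]; simp; module⟩
    · exact ⟨(![0, 1, 0, 0] : Fin 4 → ℝ), by rw [wh1Minus_apply]; simp⟩
    · exact ⟨(![0, 0, 1, 0] : Fin 4 → ℝ), by rw [wh1Minus_apply]; simp⟩
    · exact ⟨(![0, 0, 0, -2] : Fin 4 → ℝ), by rw [wh1Minus_apply]; simp; module⟩
  · intro (u : Fin 4 → ℝ)
    rw [wh1Minus_apply]
    repeat first
      | apply Submodule.add_mem
      | apply Submodule.sub_mem
      | apply Submodule.smul_mem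
      | apply Submodule.neg_mem
      | exact Submodule.subset_span (by simp)

theorem realizes_wh2 : Realizes {imag, number, gPlus 1 0, gMinus 1 0} WH2 := by
  refine Realizes.of_hom wh2Hom ?_ ?_ ?_
  · intro (u : Fin 4 → ℝ) hu
    have h := congrArg coord hu
    rw [wh2Hom_apply] at h
    simp [coord_imag, coord_number, coord_gPlus_one, coord_gMinus_one] at h
    change u = 0
    ext i; fin_cases i <;> simp <;> linarith
  · rintro b (rfl | rfl | rfl | rfl)
    · exact ⟨(![0, 0, 0, 1 / 2] : Fin 4 → ℝ), by rw [wh2Hom_apply]; simp⟩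
    · exact ⟨(![1, 0, 0, 0] : Fin 4 → ℝ), by rw [wh2Hom_apply]; simp⟩
    · exact ⟨(![0, 1, 0, 0] : Fin 4 → ℝ), by rw [wh2Hom_apply]; simp⟩
    · exact ⟨(![0, 0, -1, 0] : Fin 4 → ℝ), by rw [wh2Hom_apply]; simp⟩
  · intro (u : Fin 4 → ℝ)
    rw [wh2Hom_apply]
    repeat first
      | apply Submodule.add_mem
      | apply Submodule.sub_mem
      | apply Submodule.smul_mem
      | apply Submodule.neg_mem
      | exact Submodule.subset_span (by simp)

theorem realizes_schr : Realizes fundamental Schr := by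
  rw [fundamental]
  refine Realizes.of_hom schrHom ?_ ?_ ?_
  · intro (u : Fin 6 → ℝ) hu
    have h := congrArg coord hu
    rw [schrHom_apply] at h
    simp [coord_imag, coord_number, coord_gPlus_one, coord_gMinus_one, coord_gPlus_two, coord_gMinus_two] at h
    change u = 0
    ext i; fin_cases i <;> simp <;> linarith
  · rintro b (rfl | rfl | rfl | rfl | rfl | rfl)
    · exact ⟨(![0, 0, 0, 0, 0, 1 / 2] : Fin 6 → ℝ), by rw [schrHom_apply]; simp⟩
    -- The difference of the images of `x` and `y` is `N + i / 2`, and `z` maps to `2 i`; hence the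
    -- correction `-1 / 4`.
    · exact ⟨(![0, 1, -1, 0, 0, -1 / 4] : Fin 6 → ℝ), by rw [schrHom_apply]; simp; module⟩
    · exact ⟨(![0, 0, 0, 1, 0, 0] : Fin 6 → ℝ), by rw [schrHom_apply]; simp⟩
    · exact ⟨(![0, 0, 0, 0, -1, 0] : Fin 6 → ℝ), by rw [schrHom_apply]; simp⟩
    · exact ⟨(![0, 2, 2, 0, 0, 0] : Fin 6 → ℝ), by rw [schrHom_apply]; simp; module⟩
    · exact ⟨(![2, 0, 0, 0, 0, 0] : Fin 6 → ℝ), by rw [schrHom_apply]; simp⟩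
  · intro (u : Fin 6 → ℝ)
    rw [schrHom_apply]
    repeat first
      | apply Submodule.add_mem
      | apply Submodule.sub_mem
      | apply Submodule.smul_mem
      | apply Submodule.neg_mem
      | exact Submodule.subset_span (by simp)

/-- The traceless matrix with the given entries. -/
def slMk (a b c : ℝ) : LieAlgebra.SpecialLinear.sl (Fin 2) ℝ :=
  ⟨!![a, b; c, -a], by
    change Matrix.trace !![a, b; c, -a] = 0
    simp [Matrix.trace_fin_two]⟩

theorem slHom_slMk (a b c : ℝ) : slHom (slMk a b c) = a • (1 / 2 : ℝ) • gMinus 2 0 +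
    b • ((1 / 4 : ℝ) • gPlus 2 0 + (1 / 2 : ℝ) • number + (1 / 4 : ℝ) • imag) +
    c • ((1 / 4 : ℝ) • gPlus 2 0 + (-1 / 2 : ℝ) • number + (-1 / 4 : ℝ) • imag) := by
  rw [slHom_apply]
  simp [slMk]

theorem sl_two_eq_slMk (M : LieAlgebra.SpecialLinear.sl (Fin 2) ℝ) :
    M = slMk (M.1 0 0) (M.1 0 1) (M.1 1 0) := by
  apply Subtype.ext
  have h := sl_two_apply_one_one M
  ext i j; fin_cases i <;> fin_cases j <;> simp [slMk, h]

theorem realizes_sl :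
    Realizes {gPlus 2 0, gMinus 2 0, number + (1 / 2 : ℝ) • imag}
      (LieAlgebra.SpecialLinear.sl (Fin 2) ℝ) := by
  have hA : gPlus 2 0 ∈ Submodule.span ℝ
      {gPlus 2 0, gMinus 2 0, number + (1 / 2 : ℝ) • imag} := Submodule.subset_span (by simp)
  have hB : gMinus 2 0 ∈ Submodule.span ℝ
      {gPlus 2 0, gMinus 2 0, number + (1 / 2 : ℝ) • imag} := Submodule.subset_span (by simp)
  have hM : number + (1 / 2 : ℝ) • imag ∈ Submodule.span ℝ
      {gPlus 2 0, gMinus 2 0, number + (1 / 2 : ℝ) • imag} := Submodule.subset_span (by simp)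
  refine Realizes.of_hom slHom ?_ ?_ ?_
  · intro M hM
    have h := congrArg coord hM
    rw [slHom_apply] at h
    simp [coord_imag, coord_number, coord_gPlus_two, coord_gMinus_two] at h
    rw [sl_two_eq_slMk M, h.2.2.2, (by linarith : M.1 0 1 = 0), (by linarith : M.1 1 0 = 0)]
    apply Subtype.ext
    ext i j; fin_cases i <;> fin_cases j <;> simp [slMk]
  · rintro b (rfl | rfl | rfl)
    · exact ⟨slMk 0 2 2, by rw [slHom_slMk]; module⟩
    · exact ⟨slMk 2 0 0, by rw [slHom_slMk]; module⟩
    · exact ⟨slMk 0 1 (-1), by rw [slHom_slMk]; module⟩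
  · intro M
    -- Neither `N` nor `i` lies in the span; regrouping shows that they enter only through `N + i /
    -- 2`.
    have e : slHom M = ((M.1 0 1 + M.1 1 0) / 4) • gPlus 2 0 + (M.1 0 0 / 2) • gMinus 2 0 +
        ((M.1 0 1 - M.1 1 0) / 2) • (number + (1 / 2 : ℝ) • imag) := by
      rw [slHom_apply]; module
    rw [e]
    exact add_mem (add_mem (Submodule.smul_mem _ _ hA) (Submodule.smul_mem _ _ hB))
      (Submodule.smul_mem _ _ hM)

theorem realizes_slLine : Realizes {imag, number, gPlus 2 0, gMinus 2 0}
    (LieAlgebra.SpecialLinear.sl (Fin 2) ℝ × Line) := by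
  refine Realizes.of_hom (centralRight slHom) ?_ ?_ ?_
  · rintro ⟨M, (r : ℝ)⟩ hM
    have h := congrArg coord hM
    rw [centralRight_apply, slHom_apply] at h
    simp [coord_imag, coord_number, coord_gPlus_two, coord_gMinus_two, Line.toReal] at h
    have hr : r = 0 := by linarith
    refine Prod.ext ?_ hr
    change M = 0
    rw [sl_two_eq_slMk M, h.2.2.2, (by linarith : M.1 0 1 = 0), (by linarith : M.1 1 0 = 0)]
    apply Subtype.ext
    ext i j; fin_cases i <;> fin_cases j <;> simp [slMk]
  · rintro b (rfl | rfl | rfl | rfl)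
    · exact ⟨(slMk 0 0 0, (1 : ℝ)), by
        rw [centralRight_apply, slHom_slMk]; simp [Line.toReal]⟩
    · exact ⟨(slMk 0 1 (-1), (-1 / 2 : ℝ)), by
        rw [centralRight_apply, slHom_slMk]; simp only [Line.toReal]; module⟩
    · exact ⟨(slMk 0 2 2, (0 : ℝ)), by
        rw [centralRight_apply, slHom_slMk]; simp only [Line.toReal]; module⟩
    · exact ⟨(slMk 2 0 0, (0 : ℝ)), by
        rw [centralRight_apply, slHom_slMk]; simp only [Line.toReal]; module⟩
  · rintro ⟨M, r⟩
    rw [centralRight_apply, slHom_apply]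
    repeat first
      | apply Submodule.add_mem
      | apply Submodule.sub_mem
      | apply Submodule.smul_mem
      | apply Submodule.neg_mem
      | exact Submodule.subset_span (by simp)

/-! ### Linear independence and generation -/

/-- The fundamental monomials as a family. -/
def fundamentalFamily : Fin 6 → skewWeyl :=
  ![imag, number, gPlus 1 0, gMinus 1 0, gPlus 2 0, gMinus 2 0]

theorem linearIndependent_fundamental : LinearIndependent ℝ fundamentalFamily := by
  rw [Fintype.linearIndependent_iff]
  intro u hu
  have h := congrArg coord hu
  simp [fundamentalFamily, Fin.sum_univ_succ, coord_imag, coord_number, coord_gPlus_one,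
    coord_gMinus_one, coord_gPlus_two, coord_gMinus_two] at h
  intro i; fin_cases i <;> simp [h]

theorem linearIndepOn_fundamental : LinearIndepOn ℝ id fundamental := by
  have e : fundamental = Set.range fundamentalFamily := by
    ext x
    simp [fundamental, fundamentalFamily]
    tauto
  rw [e]
  exact linearIndependent_fundamental.linearIndepOn_id

theorem linearIndepOn_sl :
    LinearIndepOn ℝ id {gPlus 2 0, gMinus 2 0, number + (1 / 2 : ℝ) • imag} := by
  have h : LinearIndependent ℝ ![gPlus 2 0, gMinus 2 0, number + (1 / 2 : ℝ) • imag] := by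
    rw [Fintype.linearIndependent_iff]
    intro u hu
    have h := congrArg coord hu
    simp [Fin.sum_univ_succ, coord_imag, coord_number,
      coord_gPlus_two, coord_gMinus_two] at h
    intro i; fin_cases i <;> simp [h]
  have e : {gPlus 2 0, gMinus 2 0, number + (1 / 2 : ℝ) • imag} =
      Set.range ![gPlus 2 0, gMinus 2 0, number + (1 / 2 : ℝ) • imag] := by
    ext x
    simp
    tauto
  rw [e]
  exact h.linearIndepOn_id

theorem finite_fundamental : fundamental.Finite := by
  simp [fundamental]

theorem isMonomial_of_mem_fundamental {x : skewWeyl} (hx : x ∈ fundamental) : IsMonomial x := by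
  rcases hx with rfl | rfl | rfl | rfl | rfl | rfl
  · exact ⟨1 / 2, by norm_num, 0, 0, Or.inl ⟨le_rfl, by rw [gPlus_zero_zero]; module⟩⟩
  · exact ⟨1 / 2, by norm_num, 1, 1, Or.inl ⟨le_rfl, by rw [gPlus_one_one]; module⟩⟩
  · exact ⟨1, one_ne_zero, 1, 0, Or.inl ⟨zero_le_one, by rw [one_smul]⟩⟩
  · exact ⟨1, one_ne_zero, 1, 0, Or.inr ⟨zero_lt_one, by rw [one_smul]⟩⟩
  · exact ⟨1, one_ne_zero, 2, 0, Or.inl ⟨zero_le_two, by rw [one_smul]⟩⟩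
  · exact ⟨1, one_ne_zero, 2, 0, Or.inr ⟨zero_lt_two, by rw [one_smul]⟩⟩

theorem isMonomialGenerated_of_subset {B : Set skewWeyl} (hB : B ⊆ fundamental) :
    IsMonomialGenerated (lieClosure B) :=
  ⟨B, finite_fundamental.subset hB, fun _ hx => isMonomial_of_mem_fundamental (hB hx), rfl⟩

/-- The third basis vector is not a single monomial, but it equals `-[A, B] / 8`. So `A` and `B`
already generate, which makes this realization monomial-generated. -/
theorem lieClosure_gPlus_two_gMinus_two :
    lieClosure {gPlus 2 0, gMinus 2 0} =
      lieClosure {gPlus 2 0, gMinus 2 0, number + (1 / 2 : ℝ) • imag} := by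
  apply le_antisymm
  · exact LieSubalgebra.lieSpan_mono (by
      rintro x (rfl | rfl) <;> simp)
  · rw [LieSubalgebra.lieSpan_le]
    have hA : gPlus 2 0 ∈ lieClosure {gPlus 2 0, gMinus 2 0} :=
      LieSubalgebra.subset_lieSpan (by simp)
    have hB : gMinus 2 0 ∈ lieClosure {gPlus 2 0, gMinus 2 0} :=
      LieSubalgebra.subset_lieSpan (by simp)
    rintro x (rfl | rfl | rfl)
    · exact hA
    · exact hB
    · have h := SMulMemClass.smul_mem (-1 / 8 : ℝ) (LieSubalgebra.lie_mem _ hA hB)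
      rw [gPlus_two_lie_gMinus_two] at h
      have e : number + (1 / 2 : ℝ) • imag =
          (-1 / 8 : ℝ) • ((-8 : ℝ) • number + (-4 : ℝ) • imag) := by module
      rw [e]
      exact h

theorem not_isLieAbelian_lieClosure {B : Set skewWeyl} {x y : skewWeyl} (hx : x ∈ B) (hy : y ∈ B)
    (h : ⁅x, y⁆ ≠ 0) : ¬ IsLieAbelian (lieClosure B) := by
  intro hab
  apply h
  exact congrArg Subtype.val (hab.trivial ⟨x, LieSubalgebra.subset_lieSpan hx⟩
    ⟨y, LieSubalgebra.subset_lieSpan hy⟩)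

theorem Realizes.finiteDimensional {L' : Type} [LieRing L'] [LieAlgebra ℝ L'] {B : Set skewWeyl}
    (h : Realizes B L') (hB : B.Finite) : FiniteDimensional ℝ (lieClosure B) := by
  have := FiniteDimensional.span_of_finite ℝ hB
  rw [← h.toSubmodule_eq] at this
  exact this

theorem gPlus_one_ne_zero : gPlus 1 0 ≠ 0 := fun h => by
  have := congrArg coord h
  simp [coord_gPlus_one] at this

theorem gMinus_one_ne_zero : gMinus 1 0 ≠ 0 := fun h => by
  have := congrArg coord h
  simp [coord_gMinus_one] at this

theorem imag_ne_zero : imag ≠ 0 := fun h => by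
  have := congrArg coord h
  simp [coord_imag] at this

theorem gPlus_two_lie_gMinus_two_ne_zero : ⁅gPlus 2 0, gMinus 2 0⁆ ≠ 0 := fun h => by
  have := congrArg coord h
  simp [gPlus_two_lie_gMinus_two, coord_imag, coord_number] at this

/-! ### The listed realizations -/

/-- The properties of a listed realization with a basis of fundamental monomials. -/
theorem Realizes.spec {L' : Type} [LieRing L'] [LieAlgebra ℝ L'] {B : Set skewWeyl}
    (h : Realizes B L') (hB : B ⊆ fundamental) {x y : skewWeyl} (hx : x ∈ B) (hy : y ∈ B)
    (hxy : ⁅x, y⁆ ≠ 0) :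
    LinearIndepOn ℝ id B ∧ (lieClosure B).toSubmodule = Submodule.span ℝ B ∧
      FiniteDimensional ℝ (lieClosure B) ∧ ¬ IsLieAbelian (lieClosure B) ∧
      IsMonomialGenerated (lieClosure B) ∧ Nonempty (lieClosure B ≃ₗ⁅ℝ⁆ L') :=
  ⟨linearIndepOn_fundamental.mono hB, h.toSubmodule_eq,
    h.finiteDimensional (finite_fundamental.subset hB), not_isLieAbelian_lieClosure hx hy hxy,
    isMonomialGenerated_of_subset hB, h.iso⟩

theorem Kind.bases_spec (k : Kind) (B : Set skewWeyl) (hB : B ∈ k.bases) :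
    LinearIndepOn ℝ id B ∧ (lieClosure B).toSubmodule = Submodule.span ℝ B ∧
      FiniteDimensional ℝ (lieClosure B) ∧ ¬ IsLieAbelian (lieClosure B) ∧
      IsMonomialGenerated (lieClosure B) ∧ k.Iso (lieClosure B) := by
  have hBP : ⁅gMinus 2 0, gPlus 1 0⁆ ≠ 0 := by
    rw [gMinus_two_lie_gPlus_one]; exact smul_ne_zero two_ne_zero gPlus_one_ne_zero
  have hBQ : ⁅gMinus 2 0, gMinus 1 0⁆ ≠ 0 := by
    rw [gMinus_two_lie_gMinus_one]; exact smul_ne_zero (by norm_num) gMinus_one_ne_zero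
  have hPQ : ⁅gPlus 1 0, gMinus 1 0⁆ ≠ 0 := by
    rw [gPlus_one_lie_gMinus_one]; exact smul_ne_zero (by norm_num) imag_ne_zero
  have hAB := gPlus_two_lie_gMinus_two_ne_zero
  cases k with
  | aff =>
    rcases hB with rfl | rfl
    · exact realizes_affPlus.spec (by simp [Set.insert_subset_iff, fundamental])
        (by simp) (by simp) hBP
    · exact realizes_affMinus.spec (by simp [Set.insert_subset_iff, fundamental])
        (by simp) (by simp) hBQ
  | lineAff =>
    rcases hB with rfl | rfl
    · exact realizes_lineAffPlus.spec (by simp [Set.insert_subset_iff, fundamental])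
        (by simp) (by simp) hBP
    · exact realizes_lineAffMinus.spec (by simp [Set.insert_subset_iff, fundamental])
        (by simp) (by simp) hBQ
  | heis =>
    rcases hB with rfl
    exact realizes_heis.spec (by simp [Set.insert_subset_iff, fundamental])
      (by simp) (by simp) hPQ
  | sl2 =>
    rcases hB with rfl
    refine ⟨linearIndepOn_sl, realizes_sl.toSubmodule_eq,
      realizes_sl.finiteDimensional (by simp),
      not_isLieAbelian_lieClosure (by simp) (by simp) hAB, ?_, realizes_sl.iso⟩
    rw [← lieClosure_gPlus_two_gMinus_two]
    exact isMonomialGenerated_of_subset (by simp [Set.insert_subset_iff, fundamental])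
  | wh1 =>
    rcases hB with rfl | rfl
    · exact realizes_wh1Plus.spec (by simp [Set.insert_subset_iff, fundamental])
        (by simp) (by simp) hPQ
    · exact realizes_wh1Minus.spec (by simp [Set.insert_subset_iff, fundamental])
        (by simp) (by simp) hPQ
  | wh2 =>
    rcases hB with rfl
    exact realizes_wh2.spec (by simp [Set.insert_subset_iff, fundamental])
      (by simp) (by simp) hPQ
  | sl2Line =>
    rcases hB with rfl
    exact realizes_slLine.spec (by simp [Set.insert_subset_iff, fundamental])
      (by simp) (by simp) hAB
  | schr =>
    rcases hB with rfl
    exact realizes_schr.spec subset_rfl (by simp [fundamental]) (by simp [fundamental]) hPQ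

/-! ### Subalgebras generated by fundamental monomials -/

section Closure

variable {L : LieSubalgebra ℝ skewWeyl}

theorem mem_of_smul_eq {x y : skewWeyl} {c : ℝ} (hc : c ≠ 0) (h : y = c • x) (hy : y ∈ L) :
    x ∈ L := by
  rw [h] at hy
  have := SMulMemClass.smul_mem c⁻¹ hy
  rwa [smul_smul, inv_mul_cancel₀ hc, one_smul] at this

theorem imag_mem_of_gPlus_one (hP : gPlus 1 0 ∈ L) (hQ : gMinus 1 0 ∈ L) : imag ∈ L :=
  mem_of_smul_eq (by norm_num) gPlus_one_lie_gMinus_one (L.lie_mem hP hQ)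

theorem gMinus_one_mem_of_number (hN : number ∈ L) (hP : gPlus 1 0 ∈ L) : gMinus 1 0 ∈ L := by
  have := L.lie_mem hN hP
  rwa [number_lie_gPlus_one] at this

theorem gPlus_one_mem_of_number (hN : number ∈ L) (hQ : gMinus 1 0 ∈ L) : gPlus 1 0 ∈ L := by
  have := L.lie_mem hQ hN
  rwa [gMinus_one_lie_number] at this

theorem gMinus_one_mem_of_gPlus_two (hA : gPlus 2 0 ∈ L) (hP : gPlus 1 0 ∈ L) : gMinus 1 0 ∈ L :=
  mem_of_smul_eq two_ne_zero gPlus_one_lie_gPlus_two (L.lie_mem hP hA)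

theorem gPlus_one_mem_of_gPlus_two (hA : gPlus 2 0 ∈ L) (hQ : gMinus 1 0 ∈ L) : gPlus 1 0 ∈ L :=
  mem_of_smul_eq two_ne_zero gMinus_one_lie_gPlus_two (L.lie_mem hQ hA)

theorem gMinus_two_mem_of_number (hN : number ∈ L) (hA : gPlus 2 0 ∈ L) : gMinus 2 0 ∈ L :=
  mem_of_smul_eq two_ne_zero number_lie_gPlus_two (L.lie_mem hN hA)

theorem gPlus_two_mem_of_number (hN : number ∈ L) (hB : gMinus 2 0 ∈ L) : gPlus 2 0 ∈ L :=
  mem_of_smul_eq two_ne_zero gMinus_two_lie_number (L.lie_mem hB hN)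

/-- The bracket `[B, A]` yields only the combination `8 N + 4 i`; each of `N` and `i` is recovered
from it once the other is present. -/
theorem number_mem_of_gPlus_two (hA : gPlus 2 0 ∈ L) (hB : gMinus 2 0 ∈ L) (hi : imag ∈ L) :
    number ∈ L := by
  have h := sub_mem (L.lie_mem hB hA) (SMulMemClass.smul_mem (4 : ℝ) hi)
  rw [gMinus_two_lie_gPlus_two, add_sub_cancel_right] at h
  exact mem_of_smul_eq (by norm_num) rfl h

theorem imag_mem_of_gPlus_two (hA : gPlus 2 0 ∈ L) (hB : gMinus 2 0 ∈ L) (hN : number ∈ L) :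
    imag ∈ L := by
  have h := sub_mem (L.lie_mem hB hA) (SMulMemClass.smul_mem (8 : ℝ) hN)
  rw [gMinus_two_lie_gPlus_two, add_sub_cancel_left] at h
  exact mem_of_smul_eq (by norm_num) rfl h

end Closure

theorem lieClosure_eq_of_subset {T B : Set skewWeyl} (h1 : T ⊆ B) (h2 : B ⊆ lieClosure T) :
    lieClosure T = lieClosure B :=
  le_antisymm (LieSubalgebra.lieSpan_mono h1) (LieSubalgebra.lieSpan_le.2 h2)

/-- The classification of the non-abelian Lie algebras generated by fundamental monomials. -/
theorem exists_mem_bases {T : Set skewWeyl} (hT : T ⊆ fundamental)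
    (hab : ¬ IsLieAbelian (lieClosure T)) :
    ∃ k : Kind, ∃ B ∈ k.bases, lieClosure T = lieClosure B := by
  have hL : ∀ {x}, x ∈ T → x ∈ lieClosure T := fun hx => LieSubalgebra.subset_lieSpan hx
  have hTx : ∀ {x}, x ∈ T → x = imag ∨ x = number ∨ x = gPlus 1 0 ∨ x = gMinus 1 0 ∨
    x = gPlus 2 0 ∨ x = gMinus 2 0 := fun hx => hT hx
  have hcomm : ¬ ∀ x ∈ T, ∀ y ∈ T, ⁅x, y⁆ = 0 := fun h => hab (isLieAbelian_lieClosure h)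
  by_cases hPQ : gPlus 1 0 ∈ T ∨ gMinus 1 0 ∈ T
  -- Up to scalars `ad N` and `ad A` interchange `P` and `Q`, so either produces both and hence `i`;
  -- `ad B` only rescales `P` and `Q`.
  · by_cases hNA : number ∈ T ∨ gPlus 2 0 ∈ T
    · have hP : gPlus 1 0 ∈ lieClosure T := by
        rcases hPQ with h | h
        · exact hL h
        · rcases hNA with h' | h'
          · exact gPlus_one_mem_of_number (hL h') (hL h)
          · exact gPlus_one_mem_of_gPlus_two (hL h') (hL h)
      have hQ : gMinus 1 0 ∈ lieClosure T := by
        rcases hPQ with h | h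
        · rcases hNA with h' | h'
          · exact gMinus_one_mem_of_number (hL h') (hL h)
          · exact gMinus_one_mem_of_gPlus_two (hL h') (hL h)
        · exact hL h
      have hi := imag_mem_of_gPlus_one hP hQ
      by_cases hN : number ∈ T
      · by_cases hAB : gPlus 2 0 ∈ T ∨ gMinus 2 0 ∈ T
        · have hA : gPlus 2 0 ∈ lieClosure T := by
            rcases hAB with h | h
            · exact hL h
            · exact gPlus_two_mem_of_number (hL hN) (hL h)
          have hB := gMinus_two_mem_of_number (hL hN) hA
          refine ⟨.schr, _, rfl, lieClosure_eq_of_subset hT ?_⟩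
          simp [fundamental, Set.insert_subset_iff, hi, hL hN, hP, hQ, hA, hB]
        · rw [not_or] at hAB
          obtain ⟨hA, hB⟩ := hAB
          refine ⟨.wh2, _, rfl, lieClosure_eq_of_subset (fun x hx => ?_) ?_⟩
          · rcases hTx hx with rfl | rfl | rfl | rfl | rfl | rfl <;>
              first | contradiction | simp
          · simp [Set.insert_subset_iff, hi, hL hN, hP, hQ]
      · have hA := hNA.resolve_left hN
        by_cases hB : gMinus 2 0 ∈ T
        · have hN' := number_mem_of_gPlus_two (hL hA) (hL hB) hi
          refine ⟨.schr, _, rfl, lieClosure_eq_of_subset hT ?_⟩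
          simp [fundamental, Set.insert_subset_iff, hi, hN', hP, hQ, hL hA, hL hB]
        · refine ⟨.wh1, _, Or.inl rfl, lieClosure_eq_of_subset (fun x hx => ?_) ?_⟩
          · rcases hTx hx with rfl | rfl | rfl | rfl | rfl | rfl <;>
              first | contradiction | simp
          · simp [Set.insert_subset_iff, hi, hL hA, hP, hQ]
    · rw [not_or] at hNA
      obtain ⟨hN, hA⟩ := hNA
      by_cases hB : gMinus 2 0 ∈ T
      · by_cases hP : gPlus 1 0 ∈ T
        · by_cases hQ : gMinus 1 0 ∈ T
          · have hi := imag_mem_of_gPlus_one (hL hP) (hL hQ)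
            refine ⟨.wh1, _, Or.inr rfl, lieClosure_eq_of_subset (fun x hx => ?_) ?_⟩
            · rcases hTx hx with rfl | rfl | rfl | rfl | rfl | rfl <;>
              first | contradiction | simp
            · simp [Set.insert_subset_iff, hi, hL hB, hL hP, hL hQ]
          · by_cases hi : imag ∈ T
            · refine ⟨.lineAff, _, Or.inl rfl, lieClosure_eq_of_subset (fun x hx => ?_) ?_⟩
              · rcases hTx hx with rfl | rfl | rfl | rfl | rfl | rfl <;>
              first | contradiction | simp
              · simp [Set.insert_subset_iff, hL hi, hL hB, hL hP]
            · refine ⟨.aff, _, Or.inl rfl, lieClosure_eq_of_subset (fun x hx => ?_) ?_⟩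
              · rcases hTx hx with rfl | rfl | rfl | rfl | rfl | rfl <;>
              first | contradiction | simp
              · simp [Set.insert_subset_iff, hL hB, hL hP]
        · have hQ := hPQ.resolve_left hP
          by_cases hi : imag ∈ T
          · refine ⟨.lineAff, _, Or.inr rfl, lieClosure_eq_of_subset (fun x hx => ?_) ?_⟩
            · rcases hTx hx with rfl | rfl | rfl | rfl | rfl | rfl <;>
              first | contradiction | simp
            · simp [Set.insert_subset_iff, hL hi, hL hB, hL hQ]
          · refine ⟨.aff, _, Or.inr rfl, lieClosure_eq_of_subset (fun x hx => ?_) ?_⟩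
            · rcases hTx hx with rfl | rfl | rfl | rfl | rfl | rfl <;>
              first | contradiction | simp
            · simp [Set.insert_subset_iff, hL hB, hL hQ]
      -- Only `i`, `P`, `Q` are left, and the sole nonzero bracket among them is `[P, Q]`.
      · have hPQ' : gPlus 1 0 ∈ T ∧ gMinus 1 0 ∈ T := by
          by_contra h
          refine hcomm fun x hx y hy => ?_
          rcases hTx hx with rfl | rfl | rfl | rfl | rfl | rfl <;>
            rcases hTx hy with rfl | rfl | rfl | rfl | rfl | rfl <;>
            first
              | exact lie_self _
              | exact imag_lie _
              | exact lie_imag _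
              | contradiction
              | exact (h ⟨hx, hy⟩).elim
              | exact (h ⟨hy, hx⟩).elim
        have hi := imag_mem_of_gPlus_one (hL hPQ'.1) (hL hPQ'.2)
        refine ⟨.heis, _, rfl, lieClosure_eq_of_subset (fun x hx => ?_) ?_⟩
        · rcases hTx hx with rfl | rfl | rfl | rfl | rfl | rfl <;>
              first | contradiction | simp
        · simp [Set.insert_subset_iff, hi, hL hPQ'.1, hL hPQ'.2]
  · rw [not_or] at hPQ
    obtain ⟨hP, hQ⟩ := hPQ
    by_cases hN : number ∈ T
    · have hAB : gPlus 2 0 ∈ T ∨ gMinus 2 0 ∈ T := by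
        by_contra h
        rw [not_or] at h
        obtain ⟨hA, hB⟩ := h
        refine hcomm fun x hx y hy => ?_
        rcases hTx hx with rfl | rfl | rfl | rfl | rfl | rfl <;>
          rcases hTx hy with rfl | rfl | rfl | rfl | rfl | rfl <;>
          first
            | exact lie_self _
            | exact imag_lie _
            | exact lie_imag _
            | contradiction
      have hA : gPlus 2 0 ∈ lieClosure T := by
        rcases hAB with h | h
        · exact hL h
        · exact gPlus_two_mem_of_number (hL hN) (hL h)
      have hB := gMinus_two_mem_of_number (hL hN) hA
      have hi := imag_mem_of_gPlus_two hA hB (hL hN)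
      refine ⟨.sl2Line, _, rfl, lieClosure_eq_of_subset (fun x hx => ?_) ?_⟩
      · rcases hTx hx with rfl | rfl | rfl | rfl | rfl | rfl <;>
              first | contradiction | simp
      · simp [Set.insert_subset_iff, hi, hL hN, hA, hB]
    · have hAB : gPlus 2 0 ∈ T ∧ gMinus 2 0 ∈ T := by
        by_contra h
        refine hcomm fun x hx y hy => ?_
        rcases hTx hx with rfl | rfl | rfl | rfl | rfl | rfl <;>
          rcases hTx hy with rfl | rfl | rfl | rfl | rfl | rfl <;>
          first
            | exact lie_self _
            | exact imag_lie _
            | exact lie_imag _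
            | contradiction
            | exact (h ⟨hx, hy⟩).elim
            | exact (h ⟨hy, hx⟩).elim
      obtain ⟨hA, hB⟩ := hAB
      -- Here `T` contains `A` and `B` but not `N`; whether `i` is present decides between `sl(2)`
      -- and its sum with the central line.
      by_cases hi : imag ∈ T
      · have hN' := number_mem_of_gPlus_two (hL hA) (hL hB) (hL hi)
        refine ⟨.sl2Line, _, rfl, lieClosure_eq_of_subset (fun x hx => ?_) ?_⟩
        · rcases hTx hx with rfl | rfl | rfl | rfl | rfl | rfl <;>
              first | contradiction | simp
        · simp [Set.insert_subset_iff, hL hi, hN', hL hA, hL hB]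
      · refine ⟨.sl2, _, rfl, ?_⟩
        rw [← lieClosure_gPlus_two_gMinus_two]
        refine lieClosure_eq_of_subset (fun x hx => ?_) ?_
        · rcases hTx hx with rfl | rfl | rfl | rfl | rfl | rfl <;>
              first | contradiction | simp
        · simp [Set.insert_subset_iff, hL hA, hL hB]

/-- Nonzero rescaling of generators does not change the Lie closure, so only subsets of the six
monomials have to be examined. -/
theorem exists_subset_fundamental {G : Set skewWeyl}
    (hG : ∀ x ∈ G, ∃ c : ℝ, c ≠ 0 ∧ ∃ y ∈ fundamental, x = c • y) :
    ∃ T ⊆ fundamental, lieClosure G = lieClosure T := by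
  refine ⟨{y ∈ fundamental | ∃ c : ℝ, c ≠ 0 ∧ c • y ∈ G}, fun _ hy => hy.1, le_antisymm ?_ ?_⟩
  · refine LieSubalgebra.lieSpan_le.2 fun x hx => ?_
    obtain ⟨c, hc, y, hy, rfl⟩ := hG x hx
    exact SMulMemClass.smul_mem c (LieSubalgebra.subset_lieSpan ⟨hy, c, hc, hx⟩)
  · refine LieSubalgebra.lieSpan_le.2 ?_
    rintro y ⟨-, c, hc, hy⟩
    exact mem_of_smul_eq hc rfl (LieSubalgebra.subset_lieSpan hy)

/-! ### Isomorphism invariants -/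

/-- Some inner derivation has the eigenvalue `1`. -/
def HasUnitWeight (L : Type) [LieRing L] : Prop := ∃ x y : L, y ≠ 0 ∧ ⁅x, y⁆ = y

/-- The center is nontrivial. -/
def HasCenter (L : Type) [LieRing L] : Prop := ∃ z : L, z ≠ 0 ∧ ∀ x : L, ⁅z, x⁆ = 0

/-- Some commutator is a nonzero central element. -/
def HasCentralCommutator (L : Type) [LieRing L] : Prop :=
  ∃ x y : L, ⁅x, y⁆ ≠ 0 ∧ ∀ w : L, ⁅⁅x, y⁆, w⁆ = 0

section Transfer

variable {L L' : Type} [LieRing L] [LieAlgebra ℝ L] [LieRing L'] [LieAlgebra ℝ L']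

theorem HasUnitWeight.map (e : L ≃ₗ⁅ℝ⁆ L') (h : HasUnitWeight L) : HasUnitWeight L' := by
  obtain ⟨x, y, hy, hxy⟩ := h
  exact ⟨e x, e y, fun h => hy (e.injective (h.trans (map_zero (e : L →ₗ⁅ℝ⁆ L')).symm)), by
    rw [← LieEquiv.map_lie, hxy]⟩

theorem HasCenter.map (e : L ≃ₗ⁅ℝ⁆ L') (h : HasCenter L) : HasCenter L' := by
  obtain ⟨z, hz, hc⟩ := h
  refine ⟨e z, fun h => hz (e.injective (h.trans (map_zero (e : L →ₗ⁅ℝ⁆ L')).symm)), fun x => ?_⟩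
  obtain ⟨x, rfl⟩ : ∃ x', e x' = x := e.surjective x
  rw [← LieEquiv.map_lie, hc]
  exact map_zero (e : L →ₗ⁅ℝ⁆ L')

theorem HasCentralCommutator.map (e : L ≃ₗ⁅ℝ⁆ L') (h : HasCentralCommutator L) :
    HasCentralCommutator L' := by
  obtain ⟨x, y, hz, hc⟩ := h
  refine ⟨e x, e y, fun h => ?_, fun w => ?_⟩
  · rw [← LieEquiv.map_lie] at h
    exact hz (e.injective (h.trans (map_zero (e : L →ₗ⁅ℝ⁆ L')).symm))
  · obtain ⟨w, rfl⟩ : ∃ w', e w' = w := e.surjective w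
    rw [← LieEquiv.map_lie, ← LieEquiv.map_lie, hc]
    exact map_zero (e : L →ₗ⁅ℝ⁆ L')

theorem finrank_eq_of_lieEquiv (e : L ≃ₗ⁅ℝ⁆ L') : finrank ℝ L = finrank ℝ L' :=
  e.toLinearEquiv.finrank_eq

end Transfer

/-! ### Dimensions and invariants of the named algebras -/

theorem finrank_aff : finrank ℝ Aff = 2 := (finrank_fin_fun ℝ : finrank ℝ (Fin 2 → ℝ) = 2)

theorem finrank_heis : finrank ℝ Heis = 3 := (finrank_fin_fun ℝ : finrank ℝ (Fin 3 → ℝ) = 3)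

theorem finrank_wh1 : finrank ℝ WH1 = 4 := (finrank_fin_fun ℝ : finrank ℝ (Fin 4 → ℝ) = 4)

theorem finrank_wh2 : finrank ℝ WH2 = 4 := (finrank_fin_fun ℝ : finrank ℝ (Fin 4 → ℝ) = 4)

theorem finrank_schr : finrank ℝ Schr = 6 := (finrank_fin_fun ℝ : finrank ℝ (Fin 6 → ℝ) = 6)

/-- Coordinates on traceless matrices. -/
def slEquiv : LieAlgebra.SpecialLinear.sl (Fin 2) ℝ ≃ₗ[ℝ] (Fin 3 → ℝ) where
  toFun M := ![M.1 0 0, M.1 0 1, M.1 1 0]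
  invFun u := slMk (u 0) (u 1) (u 2)
  map_add' M M' := by ext i; fin_cases i <;> rfl
  map_smul' c M := by ext i; fin_cases i <;> rfl
  left_inv M := (sl_two_eq_slMk M).symm
  right_inv u := by ext i; fin_cases i <;> rfl

theorem finrank_sl : finrank ℝ (LieAlgebra.SpecialLinear.sl (Fin 2) ℝ) = 3 := by
  rw [slEquiv.finrank_eq, finrank_fin_fun]

theorem finrank_line_prod_aff : finrank ℝ (Line × Aff) = 3 := by
  have : finrank ℝ (ℝ × (Fin 2 → ℝ)) = 3 := by simp
  exact this

theorem finrank_sl_prod_line :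
    finrank ℝ (LieAlgebra.SpecialLinear.sl (Fin 2) ℝ × Line) = 4 := by
  have h : finrank ℝ ((Fin 3 → ℝ) × ℝ) = 4 := by simp
  rw [← h]
  exact (slEquiv.prodCongr (LinearEquiv.refl ℝ ℝ)).finrank_eq

theorem slMk_lie_slMk (a b c a' b' c' : ℝ) : ⁅slMk a b c, slMk a' b' c'⁆ =
    slMk (b * c' - b' * c) (2 * (a * b' - a' * b)) (2 * (c * a' - c' * a)) := by
  apply Subtype.ext
  rw [LieAlgebra.SpecialLinear.sl_bracket]
  ext i j
  fin_cases i <;> fin_cases j <;> simp [slMk] <;> ring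

theorem slMk_inj {a b c a' b' c' : ℝ} :
    slMk a b c = slMk a' b' c' ↔ a = a' ∧ b = b' ∧ c = c' := by
  constructor
  · intro h
    have h0 := congrArg slEquiv h
    exact ⟨congrFun h0 0, congrFun h0 1, congrFun h0 2⟩
  · rintro ⟨rfl, rfl, rfl⟩
    rfl

theorem slMk_zero : slMk 0 0 0 = 0 := by
  apply slEquiv.injective
  rw [map_zero]
  ext i; fin_cases i <;> rfl

theorem hasUnitWeight_line_prod_aff : HasUnitWeight (Line × Aff) := by
  refine ⟨((0 : ℝ), (![1, 0] : Fin 2 → ℝ)), ((0 : ℝ), (![0, 1] : Fin 2 → ℝ)), fun h => ?_, ?_⟩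
  · exact one_ne_zero (congrFun (congrArg Prod.snd h) 1 : (1 : ℝ) = 0)
  · refine Prod.ext rfl ?_
    change affBr ![1, 0] ![0, 1] = ![0, 1]
    simp [affBr]

theorem hasCenter_line_prod_aff : HasCenter (Line × Aff) := by
  refine ⟨((1 : ℝ), (0 : Fin 2 → ℝ)), fun h => ?_, fun x => ?_⟩
  · exact (one_ne_zero : (1 : ℝ) ≠ 0) (congrArg Prod.fst h)
  · exact Prod.ext rfl (zero_lie (x.2 : Aff))

/-- If `[x, y] = y`, then `y` is a commutator, hence central, so `y = [x, y] = 0`. -/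
theorem not_hasUnitWeight_heis : ¬ HasUnitWeight Heis := by
  rintro ⟨(x : Fin 3 → ℝ), (y : Fin 3 → ℝ), hy, h⟩
  change heisBr x y = y at h
  apply hy
  have h0 : 0 = y 0 := congrFun h 0
  have h1 : 0 = y 1 := congrFun h 1
  have h2 : x 0 * y 1 - x 1 * y 0 = y 2 := congrFun h 2
  rw [← h0, ← h1] at h2
  change y = 0
  ext i; fin_cases i <;> simp <;> linarith

theorem hasUnitWeight_sl : HasUnitWeight (LieAlgebra.SpecialLinear.sl (Fin 2) ℝ) := by
  refine ⟨slMk (1 / 2) 0 0, slMk 0 1 0, ?_, ?_⟩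
  · rw [← slMk_zero, Ne, slMk_inj]
    simp
  · rw [slMk_lie_slMk, slMk_inj]
    norm_num

theorem not_hasCenter_sl : ¬ HasCenter (LieAlgebra.SpecialLinear.sl (Fin 2) ℝ) := by
  rintro ⟨M, hM, h⟩
  rw [sl_two_eq_slMk M] at hM h
  have h1 := h (slMk 1 0 0)
  have h2 := h (slMk 0 1 0)
  rw [slMk_lie_slMk, ← slMk_zero, slMk_inj] at h1 h2
  rw [← slMk_zero, Ne, slMk_inj] at hM
  exact hM ⟨by linarith, by linarith, by linarith⟩

theorem hasUnitWeight_wh1 : HasUnitWeight WH1 := by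
  refine ⟨(![0, 0, 0, -1] : Fin 4 → ℝ), (![0, 1, 0, 0] : Fin 4 → ℝ), fun h => ?_, ?_⟩
  · exact one_ne_zero (congrFun h 1 : (1 : ℝ) = 0)
  · change wh1Br ![0, 0, 0, -1] ![0, 1, 0, 0] = ![0, 1, 0, 0]
    ext i; fin_cases i <;> simp [wh1Br]

theorem hasCentralCommutator_wh1 : HasCentralCommutator WH1 := by
  have e : wh1Br ![0, 1, 0, 0] ![0, 0, 1, 0] = ![1, 0, 0, 0] := by
    ext i; fin_cases i <;> simp [wh1Br]
  refine ⟨(![0, 1, 0, 0] : Fin 4 → ℝ), (![0, 0, 1, 0] : Fin 4 → ℝ), fun h => ?_, ?_⟩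
  · exact one_ne_zero (congrFun (e.symm.trans h) 0 : (1 : ℝ) = 0)
  · intro (w : Fin 4 → ℝ)
    change wh1Br (wh1Br ![0, 1, 0, 0] ![0, 0, 1, 0]) w = 0
    rw [e]
    ext i; fin_cases i <;> simp [wh1Br]

theorem not_hasUnitWeight_wh2 : ¬ HasUnitWeight WH2 := by
  rintro ⟨(x : Fin 4 → ℝ), (y : Fin 4 → ℝ), hy, h⟩
  change wh2Br x y = y at h
  apply hy
  have h0 : 0 = y 0 := congrFun h 0
  have h1 : x 0 * y 2 - x 2 * y 0 = y 1 := congrFun h 1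
  have h2 : -(x 0 * y 1 - x 1 * y 0) = y 2 := congrFun h 2
  have h3 : x 1 * y 2 - x 2 * y 1 = y 3 := congrFun h 3
  rw [← h0, mul_zero, sub_zero] at h1 h2
  -- On the plane of `q` and `p` modulo the center, `ad x` is `x 0` times a quarter turn. Its
  -- eigenvalues are imaginary, whence the nonzero factor `1 + x 0 ^ 2`.
  have h4 : y 1 = 0 := by
    have : y 1 * (1 + x 0 ^ 2) = 0 := by linear_combination -h1 - x 0 * h2
    exact (mul_eq_zero.1 this).resolve_right (by positivity)
  rw [h4, mul_zero, neg_zero] at h2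
  rw [h4, ← h2] at h3
  change y = 0
  ext i; fin_cases i <;> simp <;> linarith

theorem hasUnitWeight_sl_prod_line :
    HasUnitWeight (LieAlgebra.SpecialLinear.sl (Fin 2) ℝ × Line) := by
  obtain ⟨x, y, hy, h⟩ := hasUnitWeight_sl
  exact ⟨(x, 0), (y, 0), fun h => hy (congrArg Prod.fst h), Prod.ext h rfl⟩

/-- Commutators have no component in the line, and `sl(2)` has trivial center. Unlike in `wh₁`, the
center is therefore not reached by commutators. -/
theorem not_hasCentralCommutator_sl_prod_line :
    ¬ HasCentralCommutator (LieAlgebra.SpecialLinear.sl (Fin 2) ℝ × Line) := by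
  rintro ⟨x, y, hz, h⟩
  refine not_hasCenter_sl ⟨⁅x.1, y.1⁆, fun h0 => hz (Prod.ext h0 rfl), fun w => ?_⟩
  exact congrArg Prod.fst (h (w, 0))

/-- Invariants that separate the named algebras. -/
def Kind.Invariants (k : Kind) (L : Type) [LieRing L] [LieAlgebra ℝ L] : Prop :=
  match k with
  | .aff => finrank ℝ L = 2
  | .lineAff => finrank ℝ L = 3 ∧ HasUnitWeight L ∧ HasCenter L
  | .heis => finrank ℝ L = 3 ∧ ¬ HasUnitWeight L
  | .sl2 => finrank ℝ L = 3 ∧ HasUnitWeight L ∧ ¬ HasCenter L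
  | .wh1 => finrank ℝ L = 4 ∧ HasUnitWeight L ∧ HasCentralCommutator L
  | .wh2 => finrank ℝ L = 4 ∧ ¬ HasUnitWeight L
  | .sl2Line => finrank ℝ L = 4 ∧ HasUnitWeight L ∧ ¬ HasCentralCommutator L
  | .schr => finrank ℝ L = 6

theorem Kind.Iso.invariants {k : Kind} {L : Type} [LieRing L] [LieAlgebra ℝ L] (h : k.Iso L) :
    k.Invariants L := by
  cases k <;> obtain ⟨e⟩ := h
  · exact (finrank_eq_of_lieEquiv e).trans finrank_aff
  · exact ⟨(finrank_eq_of_lieEquiv e).trans finrank_line_prod_aff,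
      hasUnitWeight_line_prod_aff.map e.symm, hasCenter_line_prod_aff.map e.symm⟩
  · exact ⟨(finrank_eq_of_lieEquiv e).trans finrank_heis,
      fun h => not_hasUnitWeight_heis (h.map e)⟩
  · exact ⟨(finrank_eq_of_lieEquiv e).trans finrank_sl,
      hasUnitWeight_sl.map e.symm, fun h => not_hasCenter_sl (h.map e)⟩
  · exact ⟨(finrank_eq_of_lieEquiv e).trans finrank_wh1,
      hasUnitWeight_wh1.map e.symm, hasCentralCommutator_wh1.map e.symm⟩
  · exact ⟨(finrank_eq_of_lieEquiv e).trans finrank_wh2,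
      fun h => not_hasUnitWeight_wh2 (h.map e)⟩
  · exact ⟨(finrank_eq_of_lieEquiv e).trans finrank_sl_prod_line,
      hasUnitWeight_sl_prod_line.map e.symm,
      fun h => not_hasCentralCommutator_sl_prod_line (h.map e)⟩
  · exact (finrank_eq_of_lieEquiv e).trans finrank_schr

/-- Dimensions 2 and 6 occur once. In dimensions 3 and 4 the eigenvalue `1` singles out `h₁` and
`wh₂`, which lack it. The center then separates `ℝ ⊕ aff(1)` from `sl(2)`, and a nonzero central
commutator separates `wh₁` from `sl(2) ⊕ ℝ`. -/
theorem Kind.eq_of_iso (k l : Kind) (L : Type) [LieRing L] [LieAlgebra ℝ L] (hk : k.Iso L)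
    (hl : l.Iso L) : k = l := by
  have h1 := hk.invariants
  have h2 := hl.invariants
  cases k <;> cases l <;> simp only [Kind.Invariants] at h1 h2 <;>
    first
      | rfl
      | (exfalso; omega)
      | (exfalso; tauto)

/-! ### Counting the realizations -/

/-- The listed bases as a family. -/
def basisFamily : Fin 11 → Set skewWeyl :=
  ![{gPlus 1 0, gMinus 2 0}, {gMinus 1 0, gMinus 2 0}, {imag, gPlus 1 0, gMinus 2 0},
    {imag, gMinus 1 0, gMinus 2 0}, {imag, gPlus 1 0, gMinus 1 0},
    {gPlus 2 0, gMinus 2 0, number + (1 / 2 : ℝ) • imag},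
    {imag, gPlus 1 0, gMinus 1 0, gPlus 2 0}, {imag, gPlus 1 0, gMinus 1 0, gMinus 2 0},
    {imag, number, gPlus 1 0, gMinus 1 0}, {imag, number, gPlus 2 0, gMinus 2 0}, fundamental]

/-- The indices of the fundamental monomials contained in the listed realizations. -/
def indexFamily : Fin 11 → Finset (Fin 6) :=
  ![{2, 5}, {3, 5}, {0, 2, 5}, {0, 3, 5}, {0, 2, 3}, {4, 5}, {0, 2, 3, 4}, {0, 2, 3, 5},
    {0, 1, 2, 3}, {0, 1, 4, 5}, {0, 1, 2, 3, 4, 5}]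

theorem indexFamily_injective : Function.Injective indexFamily := by
  unfold Function.Injective indexFamily
  decide

theorem iUnion_realizations :
    (⋃ k : Kind, k.realizations) = Set.range fun i => lieClosure (basisFamily i) := by
  ext L
  rw [Set.mem_iUnion]
  constructor
  · rintro ⟨k, B, hB, rfl⟩
    cases k with
    | aff =>
      rcases hB with rfl | rfl
      · exact ⟨0, rfl⟩
      · exact ⟨1, rfl⟩
    | lineAff =>
      rcases hB with rfl | rfl
      · exact ⟨2, rfl⟩
      · exact ⟨3, rfl⟩
    | heis => rcases hB with rfl; exact ⟨4, rfl⟩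
    | sl2 => rcases hB with rfl; exact ⟨5, rfl⟩
    | wh1 =>
      rcases hB with rfl | rfl
      · exact ⟨6, rfl⟩
      · exact ⟨7, rfl⟩
    | wh2 => rcases hB with rfl; exact ⟨8, rfl⟩
    | sl2Line => rcases hB with rfl; exact ⟨9, rfl⟩
    | schr => rcases hB with rfl; exact ⟨10, rfl⟩
  · rintro ⟨i, rfl⟩
    fin_cases i
    · exact ⟨.aff, _, Or.inl rfl, rfl⟩
    · exact ⟨.aff, _, Or.inr rfl, rfl⟩
    · exact ⟨.lineAff, _, Or.inl rfl, rfl⟩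
    · exact ⟨.lineAff, _, Or.inr rfl, rfl⟩
    · exact ⟨.heis, _, rfl, rfl⟩
    · exact ⟨.sl2, _, rfl, rfl⟩
    · exact ⟨.wh1, _, Or.inl rfl, rfl⟩
    · exact ⟨.wh1, _, Or.inr rfl, rfl⟩
    · exact ⟨.wh2, _, rfl, rfl⟩
    · exact ⟨.sl2Line, _, rfl, rfl⟩
    · exact ⟨.schr, _, rfl, rfl⟩

/-- Since the closure is just the span of `B`, linear independence of the six monomials prevents any
monomial outside `B` from belonging to it. -/
theorem Realizes.fundamentalFamily_mem_iff {L' : Type} [LieRing L'] [LieAlgebra ℝ L']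
    {B : Set skewWeyl} (h : Realizes B L') {s : Finset (Fin 6)}
    (hB : B = fundamentalFamily '' s) (j : Fin 6) :
    fundamentalFamily j ∈ lieClosure B ↔ j ∈ s := by
  constructor
  · intro hj
    by_contra hjs
    have hj' : fundamentalFamily j ∈ Submodule.span ℝ B := by rw [← h.toSubmodule_eq]; exact hj
    rw [hB] at hj'
    exact linearIndependent_fundamental.notMem_span_image (by simpa using hjs) hj'
  · intro hj
    exact LieSubalgebra.subset_lieSpan (hB ▸ ⟨j, hj, rfl⟩)

/-- This basis is not made of fundamental monomials, so coordinates are compared directly: in the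
span the `i` coordinate is always half the `N` coordinate. -/
theorem fundamentalFamily_mem_sl_iff (j : Fin 6) :
    fundamentalFamily j ∈ lieClosure {gPlus 2 0, gMinus 2 0, number + (1 / 2 : ℝ) • imag} ↔
      j ∈ ({4, 5} : Finset (Fin 6)) := by
  constructor
  · intro hj
    have hj' : fundamentalFamily j ∈ Submodule.span ℝ
        {gPlus 2 0, gMinus 2 0, number + (1 / 2 : ℝ) • imag} := by
      rw [← realizes_sl.toSubmodule_eq]; exact hj
    obtain ⟨x, y, z, h⟩ := Submodule.mem_span_triple.1 hj'
    have h' := congrArg coord h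
    fin_cases j <;>
      simp [fundamentalFamily, coord_imag, coord_number, coord_gPlus_one, coord_gMinus_one,
        coord_gPlus_two, coord_gMinus_two] at h' ⊢
    · linarith
    · linarith
  · intro hj
    simp only [Finset.mem_insert, Finset.mem_singleton] at hj
    rcases hj with rfl | rfl
    · exact LieSubalgebra.subset_lieSpan (by simp [fundamentalFamily])
    · exact LieSubalgebra.subset_lieSpan (by simp [fundamentalFamily])

theorem fundamentalFamily_mem_basisFamily_iff (i : Fin 11) (j : Fin 6) :
    fundamentalFamily j ∈ lieClosure (basisFamily i) ↔ j ∈ indexFamily i := by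
  fin_cases i
  · exact realizes_affPlus.fundamentalFamily_mem_iff
      (by simp [indexFamily, fundamentalFamily, Set.image_insert_eq]) j
  · exact realizes_affMinus.fundamentalFamily_mem_iff
      (by simp [indexFamily, fundamentalFamily, Set.image_insert_eq]) j
  · exact realizes_lineAffPlus.fundamentalFamily_mem_iff
      (by simp [indexFamily, fundamentalFamily, Set.image_insert_eq]) j
  · exact realizes_lineAffMinus.fundamentalFamily_mem_iff
      (by simp [indexFamily, fundamentalFamily, Set.image_insert_eq]) j
  · exact realizes_heis.fundamentalFamily_mem_iff
      (by simp [indexFamily, fundamentalFamily, Set.image_insert_eq]) j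
  · exact fundamentalFamily_mem_sl_iff j
  · exact realizes_wh1Plus.fundamentalFamily_mem_iff
      (by simp [indexFamily, fundamentalFamily, Set.image_insert_eq]) j
  · exact realizes_wh1Minus.fundamentalFamily_mem_iff
      (by simp [indexFamily, fundamentalFamily, Set.image_insert_eq]) j
  · exact realizes_wh2.fundamentalFamily_mem_iff
      (by simp [indexFamily, fundamentalFamily, Set.image_insert_eq]) j
  · exact realizes_slLine.fundamentalFamily_mem_iff
      (by simp [indexFamily, fundamentalFamily, Set.image_insert_eq]) j
  · exact realizes_schr.fundamentalFamily_mem_iff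
      (by simp [indexFamily, fundamental, fundamentalFamily, Set.image_insert_eq]) j

/-- Among the eleven subalgebras, each is determined by the set of fundamental monomials that it
contains; these index sets are pairwise distinct. -/
theorem ncard_iUnion_realizations : (⋃ k : Kind, k.realizations).ncard = 11 := by
  have hinj : Function.Injective fun i => lieClosure (basisFamily i) := by
    intro i i' h
    apply indexFamily_injective
    ext j
    rw [← fundamentalFamily_mem_basisFamily_iff, ← fundamentalFamily_mem_basisFamily_iff]
    exact iff_of_eq (congrArg (fundamentalFamily j ∈ ·) h)
  rw [iUnion_realizations, ← Set.image_univ, Set.ncard_image_of_injective _ hinj,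
    Set.ncard_univ, Nat.card_eq_fintype_card, Fintype.card_fin]

end SkewWeyl

end

theorem mainTheorem1 :
    -- Every non-abelian finite-dimensional Lie subalgebra generated by a finite set of single
    -- monomials has its generators among the six fundamental monomials (up to nonzero real
    -- multiples) and is one of the listed realizations.
    (∀ G : Set skewWeyl, G.Finite → (∀ x ∈ G, IsMonomial x) →
      FiniteDimensional ℝ (lieClosure G) → ¬ IsLieAbelian (lieClosure G) →
        (∀ x ∈ G, ∃ c : ℝ, c ≠ 0 ∧ ∃ y ∈ fundamental, x = c • y) ∧
        ∃ k : Kind, lieClosure G ∈ k.realizations ∧ k.Iso (lieClosure G)) ∧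
    -- Every listed realization is such a subalgebra, has the listed vector space basis, and is
    -- isomorphic to the named algebra.
    (∀ k : Kind, ∀ B ∈ k.bases,
      LinearIndepOn ℝ id B ∧
      (lieClosure B).toSubmodule = Submodule.span ℝ B ∧
      FiniteDimensional ℝ (lieClosure B) ∧ ¬ IsLieAbelian (lieClosure B) ∧
      IsMonomialGenerated (lieClosure B) ∧
      k.Iso (lieClosure B)) ∧
    -- The eight algebras are pairwise non-isomorphic.
    (∀ (k l : Kind) (L : Type) [LieRing L] [LieAlgebra ℝ L], k.Iso L → l.Iso L → k = l) ∧
    -- The eleven listed realizations are distinct.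
    (⋃ k : Kind, k.realizations).ncard = 11 := by
  refine ⟨fun G _ hG hfin hab => ?_, Kind.bases_spec, fun k l L => ?_, ncard_iUnion_realizations⟩
  · have hfund := fundamental_of_not_isLieAbelian hG hab
    refine ⟨hfund, ?_⟩
    obtain ⟨T, hT, hGT⟩ := exists_subset_fundamental hfund
    rw [hGT] at hab ⊢
    obtain ⟨k, B, hB, hTB⟩ := exists_mem_bases hT hab
    rw [hTB]
    exact ⟨k, ⟨B, hB, rfl⟩, (k.bases_spec B hB).2.2.2.2.2⟩
  · intro _ _ hk hl
    exact k.eq_of_iso l L hk hl
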